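/- Let $R=\hat{\mathbb Z}$, $\Gamma=\mathrm{SL}_2(\mathbb Z)$, and let $M_2(\mathbb Z)^+$ be the semigroup of integral $2\times 2$ matrices of positive determinant. Let $G_2$ be the étale groupoid of pairs $(r,\rho)$ with $r\in \mathrm{GL}_2^+(\mathbb Q)$ (discrete), $\rho\in M_2(R)$ and $r\rho\in M_2(R)$ (product in $M_2(\mathbb A_f)$), and let $A=C^*(G_2)=C(M_2(R))\rtimes M_2(\mathbb Z)^+$ be the completion of the involutive algebra $C_c(G_2)$, $$ (f_1*f_2)(r,\rho)=\sum_{s:\ s\rho\in M_2(R)} f_1(rs^{-1},s\rho)\,f_2(s,\rho),\qquad f^*(r,\rho)=\overline{f(r^{-1},r\rho)}, $$ in the norm $\sup_\pi\|\pi(f)\|$ over its unital involutive Hilbert space representations, with the time evolution extending $\sigma_t(f)(r,\rho)=\det(r)^{it}f(r,\rho)$. For a lattice $L\subset\mathbb Z^2$ (a subgroup of finite index) let $\pi_L$ be the characteristic function of $mM_2(R)$, for any $m\in M_2(\mathbb Z)^+$ with $m(\mathbb Z^2)=L$. For $g\in \mathrm{GL}_2^+(\mathbb Q)$ with $g(L)\subset\mathbb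 Z^2$ let $\mu(g,L)\in C_c(G_2)$ be given by $\mu(g,L)(g,\rho)=\pi_L(\rho)$ and $\mu(g,L)(r,\rho)=0$ for $r\ne g$. Let $C^*(M_2(\mathbb Z)^+)\subset A$ be the $\sigma$-invariant $C^*$-subalgebra generated by all $\mu(g,L)$. Let $\pi$ be the representation of $C^*(M_2(\mathbb Z)^+)$ in $\mathcal H=\ell^2(M_2(\mathbb Z)^+)$, with canonical basis $\varepsilon_m$, given by $\pi(\mu(g,L))\varepsilon_m=\varepsilon_{gm}$ if the columns of $m$ belong to $L$, and $\pi(\mu(g,L))\varepsilon_m=0$ otherwise. Let $H\varepsilon_m=\log\det(m)\,\varepsilon_m$, and let $\Gamma$ act in $\mathcal H$ by $\rho(\gamma)\varepsilon_m=\varepsilon_{m\gamma^{-1}}$. On the commutant of $\rho(\Gamma)$ let $\mathrm{Trace}_\Gamma(T)=\sum_{[m]\in M_2(\mathbb Z)^+/\Gamma}\langle\varepsilon_m,T\varepsilon_m\rangle$, whenever this sum converges absolutely. Put $$\varphi_\beta(x)=\mathrm{Trace}_\Gamma(\pi(x)e^{-\beta H}),\qquad Z(\beta)=\mathrm{Trace}_\Gamma(e^{-\beta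 H}).$$ Then: (0) for every integer $N\ge 1$, the projection onto the closed span of the $\varepsilon_m$ with $\det m=N$ commutes with $\rho(\Gamma)$ and its $\Gamma$-trace is $\sigma_1(N)=\sum_{d\mid N}d$; (1) for every real $\beta>2$, $e^{-\beta H}$ commutes with $\rho(\Gamma)$ and has finite $\Gamma$-trace, and $Z(\beta)=\zeta(\beta)\,\zeta(\beta-1)$, where $\zeta$ is the Riemann zeta function; (2) for every real $\beta>2$, $\pi(x)e^{-\beta H}$ commutes with $\rho(\Gamma)$ and its $\Gamma$-trace converges absolutely for all $x\in C^*(M_2(\mathbb Z)^+)$, and $Z(\beta)^{-1}\varphi_\beta$ is a KMS$_\beta$ state on $(C^*(M_2(\mathbb Z)^+),\sigma_t)$: a positive linear form of value $1$ at $1$ such that for all $a,b$ there is a bounded continuous function $F$ on the strip $0\le \mathrm{Im}\,z\le\beta$, holomorphic in its interior, with $F(t)=\varphi(a\,\sigma_t(b))$ and $F(t+i\beta)=\varphi(\sigma_t(b)\,a)$ for all $t\in\mathbb R$, where $\varphi=Z(\beta)^{-1}\varphi_\beta$. -/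

import Mathlib

open scoped ENNReal ComplexOrder MatrixGroups
open Filter Topology

noncomputable section

namespace DetSystem

/-- The ring `𝔸_f` of finite adeles of `ℚ`. -/
abbrev Af : Type := IsDedekindDomain.FiniteAdeleRing ℤ ℚ

/-- The ring `R = Ẑ`, as the subring of everywhere integral elements of `𝔸_f`. -/
def Zhat : Subring Af where
  carrier := {a | ∀ v, a v ∈ v.adicCompletionIntegers ℚ}
  mul_mem' ha hb v := mul_mem (ha v) (hb v)
  one_mem' v := one_mem (v.adicCompletionIntegers ℚ)
  add_mem' ha hb v := add_mem (ha v) (hb v)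
  zero_mem' v := zero_mem (v.adicCompletionIntegers ℚ)
  neg_mem' ha v := neg_mem (ha v)

/-- `M₂(𝔸_f)`. -/
abbrev MAf : Type := Matrix (Fin 2) (Fin 2) Af

/-- `M₂(R)` as a subset of `M₂(𝔸_f)`. -/
def MR : Set MAf := {ρ | ∀ i j, ρ i j ∈ Zhat}

/-- The group `GL₂⁺(ℚ)`. -/
abbrev GQ : Type := Matrix.GLPos (Fin 2) ℚ

/-- The inclusion `M₂(ℚ) → M₂(𝔸_f)`. -/
def emb (g : Matrix (Fin 2) (Fin 2) ℚ) : MAf := g.map (algebraMap ℚ Af)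

/-- The underlying rational matrix of an element of `GL₂⁺(ℚ)`. -/
def GQ.mat (g : GQ) : Matrix (Fin 2) (Fin 2) ℚ := ((g : GL (Fin 2) ℚ) : Matrix (Fin 2) (Fin 2) ℚ)

/-- The product `g ρ` in `M₂(𝔸_f)`. -/
def act (g : GQ) (ρ : MAf) : MAf := emb (GQ.mat g) * ρ

theorem act_one (ρ : MAf) : act 1 ρ = ρ := by
  simp [act, GQ.mat, emb, Matrix.map_one]

theorem act_mul (g h : GQ) (ρ : MAf) : act (g * h) ρ = act g (act h ρ) := by
  simp [act, GQ.mat, emb, Matrix.map_mul, Matrix.mul_assoc]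

theorem continuous_act (g : GQ) : Continuous (act g) := by
  unfold act; fun_prop

theorem isClopen_Zhat : IsClopen (Zhat : Set Af) := by
  constructor
  · have : (Zhat : Set Af) = ⋂ v, (fun a : Af => a v) ⁻¹'
        (v.adicCompletionIntegers ℚ : Set (v.adicCompletion ℚ)) := by
      ext a
      rw [Set.mem_iInter]
      rfl
    rw [this]
    refine isClosed_iInter fun v => IsClosed.preimage (RestrictedProduct.continuous_eval v) ?_
    exact Valued.isClosed_valuationSubring _
  · exact RestrictedProduct.isOpen_forall_mem (fun v => Valued.isOpen_valuationSubring _)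

theorem isCompact_of_bijOn {K : Type*} [TopologicalSpace K] (p : ℕ) [Fact p.Prime]
    (e : K ≃ₜ ℚ_[p]) (s : Set K) (h : Set.BijOn e s (PadicInt.subring p)) : IsCompact s := by
  have hc : IsCompact (PadicInt.subring p : Set ℚ_[p]) :=
    isCompact_iff_compactSpace.2 (PadicInt.compactSpace p)
  have he : s = e ⁻¹' (PadicInt.subring p : Set ℚ_[p]) := by
    rw [← h.image_eq, e.injective.preimage_image]
  rw [he]
  exact e.isCompact_preimage.2 hc

theorem isCompact_Zhat : IsCompact (Zhat : Set Af) := by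
  have h1 : ∀ v : IsDedekindDomain.HeightOneSpectrum ℤ,
      CompactSpace (v.adicCompletionIntegers ℚ : Set (v.adicCompletion ℚ)) := by
    intro v
    rw [← isCompact_iff_compactSpace]
    have : Fact (Nat.Prime (Rat.HeightOneSpectrum.primesEquiv v).1) :=
      ⟨(Rat.HeightOneSpectrum.primesEquiv v).2⟩
    exact isCompact_of_bijOn _ (Rat.HeightOneSpectrum.adicCompletion.padicEquiv v).toHomeomorph _
      (Rat.HeightOneSpectrum.adicCompletion.padicEquiv_bijOn v)
  have h2 : (Zhat : Set Af) = Set.range (RestrictedProduct.structureMap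
      (fun v : IsDedekindDomain.HeightOneSpectrum ℤ => v.adicCompletion ℚ)
      (fun v => (v.adicCompletionIntegers ℚ : Set (v.adicCompletion ℚ))) cofinite) := by
    rw [RestrictedProduct.range_structureMap]; rfl
  rw [h2]
  exact isCompact_range RestrictedProduct.isEmbedding_structureMap.continuous

theorem isClopen_MR : IsClopen MR := by
  have : MR = ⋂ i, ⋂ j, (fun ρ : MAf => ρ i j) ⁻¹' (Zhat : Set Af) := by
    ext ρ; simp [MR]
  rw [this]
  exact isClopen_iInter_of_finite fun i => isClopen_iInter_of_finite fun j =>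
    isClopen_Zhat.preimage (by fun_prop)

theorem isCompact_MR : IsCompact MR := by
  have : MR = Set.univ.pi fun _ : Fin 2 => Set.univ.pi fun _ : Fin 2 => (Zhat : Set Af) := by
    ext ρ
    exact ⟨fun h i _ j _ => h i j, fun h i j => h i trivial j trivial⟩
  rw [this]
  exact isCompact_univ_pi fun _ => isCompact_univ_pi fun _ => isCompact_Zhat

/-- The groupoid `G₂` of pairs `(r, ρ)` with `r ∈ GL₂⁺(ℚ)`, `ρ ∈ M₂(R)` and `r ρ ∈ M₂(R)`. -/
@[ext] structure G2 where
  r : GQ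
  ρ : MAf
  source_mem : ρ ∈ MR
  range_mem : act r ρ ∈ MR

/-- The topology of `G₂` as a subspace of the product of the discrete space `GL₂⁺(ℚ)` and
`M₂(𝔸_f)`. -/
instance : TopologicalSpace G2 :=
  TopologicalSpace.induced G2.r ⊥ ⊓ TopologicalSpace.induced G2.ρ inferInstance

theorem continuous_ρ : Continuous G2.ρ :=
  continuous_iff_le_induced.2 inf_le_right

theorem isOpen_r (g : GQ) : IsOpen {x : G2 | x.r = g} := by
  have h : @Continuous _ _ _ ⊥ G2.r := continuous_iff_le_induced.2 inf_le_left
  exact @IsOpen.preimage _ _ _ ⊥ _ h {g} (@isOpen_discrete _ ⊥ (@DiscreteTopology.mk _ ⊥ rfl) _)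

instance : T2Space Af :=
  inferInstanceAs (T2Space (RestrictedProduct
    (fun v : IsDedekindDomain.HeightOneSpectrum ℤ => v.adicCompletion ℚ)
    (fun v => (v.adicCompletionIntegers ℚ : Set (v.adicCompletion ℚ))) cofinite))

instance : T2Space G2 where
  t2 x y hxy := by
    by_cases h : x.r = y.r
    · have hρ : x.ρ ≠ y.ρ := fun h' => hxy (G2.ext h h')
      obtain ⟨u, v, hu, hv, hxu, hyv, huv⟩ := t2_separation hρ
      exact ⟨_, _, hu.preimage continuous_ρ, hv.preimage continuous_ρ, hxu, hyv,
        huv.preimage _⟩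
    · refine ⟨_, _, isOpen_r x.r, isOpen_r y.r, rfl, rfl, ?_⟩
      rw [Set.disjoint_left]
      intro z hz hz'
      exact h (hz.symm.trans hz')

/-- The slice of `G₂` over `g`. -/
def dom (g : GQ) : Set MAf := MR ∩ act g ⁻¹' MR

theorem isClopen_dom (g : GQ) : IsClopen (dom g) :=
  isClopen_MR.inter (isClopen_MR.preimage (continuous_act g))

theorem isCompact_dom (g : GQ) : IsCompact (dom g) :=
  isCompact_MR.of_isClosed_subset (isClopen_dom g).1 Set.inter_subset_left

/-- The slice as a map into `G₂`. -/
def slice (g : GQ) (ρ : dom g) : G2 := ⟨g, ρ, ρ.2.1, ρ.2.2⟩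

theorem continuous_slice (g : GQ) : Continuous (slice g) := by
  refine continuous_inf_rng.2 ⟨continuous_induced_rng.2 ?_, continuous_induced_rng.2 ?_⟩
  · exact @continuous_const _ _ _ ⊥ g
  · exact continuous_subtype_val

open Classical in
/-- Extension of a function on `G₂` by zero. -/
def ext0 (f : G2 → ℂ) (g : GQ) (ρ : MAf) : ℂ :=
  if h : ρ ∈ MR ∧ act g ρ ∈ MR then f ⟨g, ρ, h.1, h.2⟩ else 0

theorem ext0_apply (f : G2 → ℂ) (x : G2) : ext0 f x.r x.ρ = f x := by
  simp [ext0, x.source_mem, x.range_mem]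

theorem ext0_of_not (f : G2 → ℂ) {g : GQ} {ρ : MAf} (h : ρ ∉ dom g) : ext0 f g ρ = 0 := by
  rw [ext0, dif_neg]; exact h

theorem ext0_mem (f : G2 → ℂ) {g : GQ} {ρ : MAf} (h : ρ ∈ dom g) :
    ext0 f g ρ = f (slice g ⟨ρ, h⟩) := by
  rw [ext0, dif_pos (show ρ ∈ MR ∧ act g ρ ∈ MR from h)]; rfl

theorem ext0_injective {f f' : G2 → ℂ} (h : ∀ g ρ, ext0 f g ρ = ext0 f' g ρ) : f = f' := by
  funext x; rw [← ext0_apply f, ← ext0_apply f', h]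

/-- The space `C_c(G₂)` of continuous compactly supported functions on `G₂`. -/
def CcSubmodule : Submodule ℂ (G2 → ℂ) where
  carrier := {f | Continuous f ∧ HasCompactSupport f}
  add_mem' hf hg := ⟨hf.1.add hg.1, hf.2.add hg.2⟩
  zero_mem' := ⟨continuous_const, HasCompactSupport.zero⟩
  smul_mem' c _ hf := ⟨hf.1.const_smul c, hf.2.comp_left (g := fun z : ℂ => c • z) (smul_zero c)⟩

theorem continuous_ext0 {f : G2 → ℂ} (hf : Continuous f) (g : GQ) :
    Continuous (ext0 f g) := by
  have h1 : ContinuousOn (ext0 f g) (dom g) := by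
    rw [continuousOn_iff_continuous_domRestrict]
    have : (dom g).domRestrict (ext0 f g) = fun ρ => f (slice g ρ) := by
      funext ρ; exact ext0_mem f ρ.2
    rw [this]; exact hf.comp (continuous_slice g)
  have h2 : ContinuousOn (ext0 f g) (dom g)ᶜ :=
    (continuousOn_const (c := (0:ℂ))).congr fun ρ hρ => ext0_of_not f hρ
  rw [← continuousOn_univ, ← Set.union_compl_self (dom g)]
  exact h1.union_of_isOpen h2 (isClopen_dom g).2 (isClopen_dom g).compl.2

theorem finite_support {f : G2 → ℂ} (hf : HasCompactSupport f) :
    {g | ∃ ρ, ext0 f g ρ ≠ 0}.Finite := by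
  obtain ⟨t, ht⟩ := hf.isCompact.elim_finite_subcover (fun g : GQ => {x : G2 | x.r = g}) isOpen_r
    fun x _ => Set.mem_iUnion.2 ⟨x.r, rfl⟩
  refine t.finite_toSet.subset ?_
  rintro g ⟨ρ, hρ⟩
  by_cases hd : ρ ∈ dom g
  · rw [ext0_mem f hd] at hρ
    have hm := ht (subset_tsupport _ hρ)
    simp only [Set.mem_iUnion, Set.mem_ofPred_eq] at hm
    obtain ⟨g', hg', hg''⟩ := hm
    rw [show g = g' from hg'']
    exact hg'
  · exact absurd (ext0_of_not f hd) hρ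

theorem mem_Cc (F : GQ → MAf → ℂ) (hF : ∀ g, Continuous (F g)) (S : Set GQ) (hS : S.Finite)
    (hFS : ∀ g, g ∉ S → ∀ ρ ∈ dom g, F g ρ = 0) :
    (fun x : G2 => F x.r x.ρ) ∈ CcSubmodule := by
  constructor
  · rw [continuous_iff_continuousAt]
    intro x
    have h1 : ContinuousAt (fun y : G2 => F x.r y.ρ) x := ((hF x.r).comp continuous_ρ).continuousAt
    refine h1.congr ?_
    filter_upwards [(isOpen_r x.r).mem_nhds rfl] with y hy
    rw [show y.r = x.r from hy]
  · refine HasCompactSupport.intro (K := ⋃ g ∈ S, Set.range (slice g)) ?_ ?_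
    · refine hS.isCompact_biUnion fun g _ => ?_
      have : CompactSpace (dom g) := isCompact_iff_compactSpace.1 (isCompact_dom g)
      exact isCompact_range (continuous_slice g)
    · intro x hx
      refine hFS _ (fun hxS => hx ?_) _ ⟨x.source_mem, x.range_mem⟩
      exact Set.mem_biUnion hxS ⟨⟨x.ρ, x.source_mem, x.range_mem⟩, rfl⟩


/-- The involutive algebra `C_c(G₂)`, with the convolution product. -/
def CcG2 : Type := CcSubmodule

instance : AddCommGroup CcG2 := inferInstanceAs (AddCommGroup CcSubmodule)
instance : Module ℂ CcG2 := inferInstanceAs (Module ℂ CcSubmodule)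

namespace CcG2

/-- `f(g, ρ)`, extended by `0` to all pairs `(g, ρ)`. -/
def ev (f : CcG2) : GQ → MAf → ℂ := ext0 f.1

@[ext] theorem ext {f f' : CcG2} (h : ∀ g ρ, ev f g ρ = ev f' g ρ) : f = f' :=
  Subtype.ext (ext0_injective h)

theorem continuous_ev (f : CcG2) (g : GQ) : Continuous (ev f g) := continuous_ext0 f.2.1 g

theorem finite_ev (f : CcG2) : {g | ∃ ρ, ev f g ρ ≠ 0}.Finite := finite_support f.2.2

/-- The finite set of all `g` such that `f(g, ·) ≠ 0`. -/
def gsupp (f : CcG2) : Finset GQ := f.finite_ev.toFinset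

theorem mem_gsupp {f : CcG2} {g : GQ} {ρ : MAf} (h : ev f g ρ ≠ 0) : g ∈ gsupp f :=
  f.finite_ev.mem_toFinset.2 ⟨ρ, h⟩

theorem ev_of_notMem {f : CcG2} {g : GQ} (h : g ∉ gsupp f) (ρ : MAf) : ev f g ρ = 0 := by
  by_contra h'
  exact h (mem_gsupp h')

theorem ev_of_not (f : CcG2) {g : GQ} {ρ : MAf} (h : ρ ∉ dom g) : ev f g ρ = 0 :=
  ext0_of_not _ h

/-- The element of `C_c(G₂)` given by functions `F g` on `M₂(𝔸_f)`. -/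
def mk (F : GQ → MAf → ℂ) (hF : ∀ g, Continuous (F g)) (S : Set GQ) (hS : S.Finite)
    (hFS : ∀ g, g ∉ S → ∀ ρ ∈ dom g, F g ρ = 0) : CcG2 :=
  ⟨fun x => F x.r x.ρ, mem_Cc F hF S hS hFS⟩

theorem ev_mk {F : GQ → MAf → ℂ} {hF : ∀ g, Continuous (F g)} {S : Set GQ} {hS : S.Finite}
    {hFS : ∀ g, g ∉ S → ∀ ρ ∈ dom g, F g ρ = 0} {g : GQ} {ρ : MAf} (h : ρ ∈ dom g) :
    ev (mk F hF S hS hFS) g ρ = F g ρ :=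
  ext0_mem _ h

theorem ev_mk' {F : GQ → MAf → ℂ} {hF : ∀ g, Continuous (F g)} {S : Set GQ} {hS : S.Finite}
    {hFS : ∀ g, g ∉ S → ∀ ρ ∈ dom g, F g ρ = 0} (h0 : ∀ g ρ, ρ ∉ dom g → F g ρ = 0)
    (g : GQ) (ρ : MAf) : ev (mk F hF S hS hFS) g ρ = F g ρ := by
  by_cases h : ρ ∈ dom g
  · exact ev_mk h
  · rw [h0 g ρ h, ev_of_not _ h]

theorem ev_add (f f' : CcG2) (g : GQ) (ρ : MAf) : ev (f + f') g ρ = ev f g ρ + ev f' g ρ := by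
  by_cases h : ρ ∈ dom g
  · simp only [ev, ext0_mem _ h]; rfl
  · simp [ev_of_not _ h]

theorem ev_zero (g : GQ) (ρ : MAf) : ev 0 g ρ = 0 := by
  by_cases h : ρ ∈ dom g
  · simp only [ev, ext0_mem _ h]; rfl
  · simp [ev_of_not _ h]

theorem ev_smul (c : ℂ) (f : CcG2) (g : GQ) (ρ : MAf) : ev (c • f) g ρ = c * ev f g ρ := by
  by_cases h : ρ ∈ dom g
  · simp only [ev, ext0_mem _ h]; rfl
  · simp [ev_of_not _ h]

theorem ev_sum {ι : Type*} (s : Finset ι) (f : ι → CcG2) (g : GQ) (ρ : MAf) :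
    ev (∑ i ∈ s, f i) g ρ = ∑ i ∈ s, ev (f i) g ρ := by
  classical
  induction s using Finset.induction_on with
  | empty => simp [ev_zero]
  | insert a s ha ih => rw [Finset.sum_insert ha, Finset.sum_insert ha, ev_add, ih]

/-- The convolution `∑_s f₁(r s⁻¹, s ρ) f₂(s, ρ)`, over all `s` with `s ρ ∈ M₂(R)`. -/
def conv (f₁ f₂ : CcG2) (r : GQ) (ρ : MAf) : ℂ :=
  ∑ᶠ s : GQ, ev f₁ (r * s⁻¹) (act s ρ) * ev f₂ s ρ

theorem conv_eq_sum (f₁ f₂ : CcG2) (r : GQ) (ρ : MAf) :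
    conv f₁ f₂ r ρ = ∑ s ∈ gsupp f₂, ev f₁ (r * s⁻¹) (act s ρ) * ev f₂ s ρ := by
  refine finsum_eq_sum_of_support_subset _ fun s hs => ?_
  rw [Function.mem_support] at hs
  exact mem_gsupp (right_ne_zero_of_mul hs)

theorem conv_of_not (f₁ f₂ : CcG2) (r : GQ) (ρ : MAf) (h : ρ ∉ dom r) : conv f₁ f₂ r ρ = 0 := by
  rw [conv_eq_sum]
  refine Finset.sum_eq_zero fun s _ => ?_
  by_cases h1 : ρ ∈ dom s
  · rw [ev_of_not f₁, zero_mul]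
    intro h2
    refine h ⟨h1.1, ?_⟩
    have := h2.2
    rwa [Set.mem_preimage, ← act_mul, inv_mul_cancel_right] at this
  · rw [ev_of_not f₂ h1, mul_zero]

instance : Mul CcG2 where
  mul f₁ f₂ := mk (conv f₁ f₂)
    (fun g => by
      simp only [funext (conv_eq_sum f₁ f₂ g)]
      exact continuous_finsetSum _ fun s _ =>
        ((continuous_ev f₁ _).comp (continuous_act s)).mul (continuous_ev f₂ s))
    (Set.image2 (fun a b => a * b) (gsupp f₁) (gsupp f₂))
    ((Finset.finite_toSet _).image2 _ (Finset.finite_toSet _))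
    (fun g hg ρ _ => by
      rw [conv_eq_sum]
      refine Finset.sum_eq_zero fun s hs => ?_
      rw [ev_of_notMem (fun h => hg ?_), zero_mul]
      exact ⟨_, h, s, hs, inv_mul_cancel_right g s⟩)

theorem ev_mul (f₁ f₂ : CcG2) (g : GQ) (ρ : MAf) : ev (f₁ * f₂) g ρ = conv f₁ f₂ g ρ :=
  ev_mk' (conv_of_not f₁ f₂) g ρ

open Classical in
instance : One CcG2 where
  one := mk (fun g _ => if g = 1 then 1 else 0) (fun _ => continuous_const) {1}
    (Set.finite_singleton _) (fun _ hg _ _ => if_neg hg)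

open Classical in
theorem ev_one (g : GQ) (ρ : MAf) : ev 1 g ρ = if g = 1 ∧ ρ ∈ MR then 1 else 0 := by
  by_cases h : ρ ∈ dom g
  · have : ev 1 g ρ = if g = 1 then 1 else 0 := ev_mk h
    rw [this]
    simp [h.1]
  · rw [ev_of_not _ h, if_neg]
    rintro ⟨rfl, h2⟩
    exact h ⟨h2, by rwa [Set.mem_preimage, act_one]⟩

instance : Star CcG2 where
  star f := mk (fun g ρ => (starRingEnd ℂ) (ev f g⁻¹ (act g ρ)))
    (fun g => Complex.continuous_conj.comp ((continuous_ev f _).comp (continuous_act g)))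
    ((fun g => g⁻¹) '' gsupp f) ((Finset.finite_toSet _).image _)
    (fun g hg ρ _ => by
      rw [ev_of_notMem (fun h => hg ?_), map_zero]
      exact ⟨_, h, inv_inv g⟩)

theorem ev_star (f : CcG2) (g : GQ) (ρ : MAf) :
    ev (star f) g ρ = (starRingEnd ℂ) (ev f g⁻¹ (act g ρ)) := by
  refine ev_mk' (fun g ρ h => ?_) g ρ
  rw [ev_of_not, map_zero]
  intro h2
  refine h ⟨?_, h2.1⟩
  have := h2.2
  rwa [Set.mem_preimage, ← act_mul, inv_mul_cancel, act_one] at this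

theorem conv_assoc (f₁ f₂ f₃ : CcG2) : f₁ * f₂ * f₃ = f₁ * (f₂ * f₃) := by
  ext r ρ
  rw [ev_mul, ev_mul, conv_eq_sum]
  have h1 : ∀ u, ev f₁ (r * u⁻¹) (act u ρ) * ev (f₂ * f₃) u ρ =
      ∑ s ∈ gsupp f₃, ev f₁ (r * u⁻¹) (act u ρ) * (ev f₂ (u * s⁻¹) (act s ρ) * ev f₃ s ρ) := by
    intro u
    rw [ev_mul, conv_eq_sum, Finset.mul_sum]
  unfold conv
  simp only [h1]
  rw [finsum_sum_comm]
  · refine Finset.sum_congr rfl fun s _ => ?_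
    rw [← finsum_comp_equiv (Equiv.mulRight s) (f := fun u =>
      ev f₁ (r * u⁻¹) (act u ρ) * (ev f₂ (u * s⁻¹) (act s ρ) * ev f₃ s ρ)), ev_mul, conv,
      finsum_mul']
    · refine finsum_congr fun t => ?_
      simp only [Equiv.coe_mulRight, mul_inv_cancel_right]
      simp only [mul_inv_rev, act_mul, mul_assoc]
    · refine (gsupp f₂).finite_toSet.subset fun t ht => ?_
      exact mem_gsupp (right_ne_zero_of_mul ht)
  · intro s _
    refine ((gsupp f₂).finite_toSet.image (fun t => t * s)).subset fun u hu => ?_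
    have h2 := left_ne_zero_of_mul (right_ne_zero_of_mul (Function.mem_support.1 hu))
    exact ⟨_, mem_gsupp h2, inv_mul_cancel_right u s⟩

instance : Ring CcG2 where
  __ := (inferInstance : AddCommGroup CcG2)
  mul_assoc := conv_assoc
  one_mul f := by
    ext r ρ
    rw [ev_mul, conv, finsum_eq_single _ r]
    · by_cases h : ρ ∈ dom r
      · have h2 : act r ρ ∈ MR := h.2
        rw [ev_one, if_pos ⟨mul_inv_cancel r, h2⟩, one_mul]
      · rw [ev_of_not f h, mul_zero]
    · intro s hs
      rw [ev_one, if_neg, zero_mul]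
      rintro ⟨h, _⟩
      exact hs (mul_inv_eq_one.1 h).symm
  mul_one f := by
    ext r ρ
    rw [ev_mul, conv, finsum_eq_single _ 1]
    · rw [ev_one, inv_one, mul_one, act_one]
      by_cases h : ρ ∈ MR
      · rw [if_pos ⟨rfl, h⟩, mul_one]
      · rw [ev_of_not f (fun h' => h h'.1), zero_mul]
    · intro s hs
      rw [ev_one, if_neg, mul_zero]
      rintro ⟨h, _⟩
      exact hs h
  left_distrib f f' f'' := by
    ext r ρ
    rw [ev_add, ev_mul, ev_mul, ev_mul]
    unfold conv
    rw [← finsum_add_distrib]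
    · refine finsum_congr fun s => ?_
      rw [ev_add, mul_add]
    · exact (gsupp f').finite_toSet.subset fun t ht => mem_gsupp (right_ne_zero_of_mul ht)
    · exact (gsupp f'').finite_toSet.subset fun t ht => mem_gsupp (right_ne_zero_of_mul ht)
  right_distrib f f' f'' := by
    ext r ρ
    rw [ev_add, ev_mul, ev_mul, ev_mul, conv_eq_sum, conv_eq_sum, conv_eq_sum,
      ← Finset.sum_add_distrib]
    refine Finset.sum_congr rfl fun s _ => ?_
    rw [ev_add, add_mul]
  zero_mul f := by
    ext r ρ
    rw [ev_mul, conv_eq_sum, ev_zero]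
    simp [ev_zero]
  mul_zero f := by
    ext r ρ
    rw [ev_mul, conv, ev_zero]
    simp [ev_zero]
  zsmul := fun n f => n • f
  zsmul_zero' := fun f => zero_smul ℤ f
  zsmul_succ' := fun n f => SubNegMonoid.zsmul_succ' n f
  zsmul_neg' := fun n f => SubNegMonoid.zsmul_neg' n f
  neg_add_cancel := neg_add_cancel

instance : Algebra ℂ CcG2 := Algebra.ofModule
  (fun c f f' => by
    ext r ρ
    rw [ev_smul, ev_mul, ev_mul, conv_eq_sum, conv_eq_sum, Finset.mul_sum]
    refine Finset.sum_congr rfl fun s _ => ?_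
    rw [ev_smul, mul_assoc])
  (fun c f f' => by
    ext r ρ
    rw [ev_smul, ev_mul, ev_mul]
    unfold conv
    rw [mul_finsum']
    · refine finsum_congr fun s => ?_
      rw [ev_smul, mul_left_comm]
    · exact (gsupp f').finite_toSet.subset fun t ht => mem_gsupp (right_ne_zero_of_mul ht))

instance : StarRing CcG2 where
  star_involutive f := by
    ext r ρ
    rw [ev_star, ev_star, inv_inv, ← act_mul, inv_mul_cancel, act_one, Complex.conj_conj]
  star_mul f f' := by
    ext r ρ
    rw [ev_star, ev_mul, ev_mul]
    unfold conv
    have h : ∀ s, ev f (r⁻¹ * s⁻¹) (act s (act r ρ)) * ev f' s (act r ρ) =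
        (starRingEnd ℂ) (ev (star f') (r * (s * r)⁻¹) (act (s * r) ρ) *
          ev (star f) (s * r) ρ) := by
      intro s
      rw [map_mul, ev_star, ev_star, Complex.conj_conj, Complex.conj_conj, ← act_mul, ← act_mul,
        mul_inv_rev, mul_inv_rev, mul_inv_rev, mul_comm]
      simp [mul_assoc]
    rw [finsum_congr h, ← finsum_comp_equiv (Equiv.mulRight r) (f := fun s =>
      ev (star f') (r * s⁻¹) (act s ρ) * ev (star f) s ρ)]
    simp only [Equiv.coe_mulRight]
    change starAddEquiv (∑ᶠ s, _) = _
    rw [AddEquiv.map_finsum]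
    exact finsum_congr fun s => Complex.conj_conj _
  star_add f f' := by
    ext r ρ
    simp only [ev_star, ev_add, map_add]

instance : StarModule ℂ CcG2 where
  star_smul c f := by
    ext r ρ
    simp only [ev_star, ev_smul, map_mul]
    rfl

end CcG2

/-! ### Time evolution -/

/-- The determinant of an element of `GL₂⁺(ℚ)`, as a real number. -/
def detR (g : GQ) : ℝ := ((GQ.mat g).det : ℚ)

theorem detR_pos (g : GQ) : 0 < detR g := by
  have h : 0 < (GQ.mat g).det := g.2
  exact Rat.cast_pos.2 h

theorem detR_mul (g h : GQ) : detR (g * h) = detR g * detR h := by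
  simp [detR, GQ.mat, Matrix.det_mul]

theorem detR_one : detR 1 = 1 := by
  simp [detR, GQ.mat]

/-- The character `g ↦ Det(g)^{it}`. -/
def detPow (t : ℝ) (g : GQ) : ℂ := (detR g : ℂ) ^ (Complex.I * t)

theorem detPow_eq (t : ℝ) (g : GQ) :
    detPow t g = Complex.exp ((Real.log (detR g) * t : ℝ) * Complex.I) := by
  rw [detPow, Complex.cpow_def_of_ne_zero (by exact_mod_cast (detR_pos g).ne'),
    ← Complex.ofReal_log (detR_pos g).le]
  congr 1
  push_cast
  ring

theorem detPow_mul (t : ℝ) (g h : GQ) : detPow t (g * h) = detPow t g * detPow t h := by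
  rw [detPow_eq, detPow_eq, detPow_eq, ← Complex.exp_add, detR_mul,
    Real.log_mul (detR_pos g).ne' (detR_pos h).ne']
  congr 1
  push_cast
  ring

theorem detPow_one (t : ℝ) : detPow t 1 = 1 := by
  rw [detPow_eq, detR_one]; simp

theorem conj_detPow (t : ℝ) (g : GQ) : (starRingEnd ℂ) (detPow t g⁻¹) = detPow t g := by
  have h1 : Real.log (detR g⁻¹) = - Real.log (detR g) := by
    have h := congrArg Real.log (detR_mul g g⁻¹)
    rw [mul_inv_cancel, detR_one, Real.log_one, Real.log_mul (detR_pos _).ne' (detR_pos _).ne'] at h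
    linarith
  rw [detPow_eq, detPow_eq, ← Complex.exp_conj, h1, map_mul, Complex.conj_ofReal, Complex.conj_I]
  congr 1
  push_cast
  ring

namespace CcG2

/-- `σ_t(f)(r, ρ) = Det(r)^{it} f(r, ρ)`, as a function. -/
def evolveFun (t : ℝ) (f : CcG2) : CcG2 :=
  mk (fun g ρ => detPow t g * ev f g ρ) (fun g => continuous_const.mul (continuous_ev f g))
    (gsupp f) (Finset.finite_toSet _)
    (fun g hg ρ _ => by rw [ev_of_notMem (fun h => hg h), mul_zero])

theorem ev_evolveFun (t : ℝ) (f : CcG2) (g : GQ) (ρ : MAf) :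
    ev (evolveFun t f) g ρ = detPow t g * ev f g ρ :=
  ev_mk' (fun g ρ h => by rw [ev_of_not _ h, mul_zero]) g ρ

/-- The time evolution `σ_t(f)(r, ρ) = Det(r)^{it} f(r, ρ)` on `C_c(G₂)`. -/
def evolve (t : ℝ) : CcG2 →⋆ₐ[ℂ] CcG2 where
  toFun := evolveFun t
  map_one' := by
    ext g ρ
    rw [ev_evolveFun, ev_one]
    split_ifs with h
    · rw [h.1, detPow_one, mul_one]
    · rw [mul_zero]
  map_mul' f f' := by
    ext g ρ
    rw [ev_evolveFun, ev_mul, ev_mul]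
    unfold conv
    rw [mul_finsum']
    · refine finsum_congr fun s => ?_
      have h : detPow t g = detPow t (g * s⁻¹) * detPow t s := by
        rw [← detPow_mul, inv_mul_cancel_right]
      rw [ev_evolveFun, ev_evolveFun, h]
      ring
    · exact (gsupp f').finite_toSet.subset fun t ht => mem_gsupp (right_ne_zero_of_mul ht)
  map_zero' := by
    ext g ρ
    rw [ev_evolveFun, ev_zero, mul_zero]
  map_add' f f' := by
    ext g ρ
    simp only [ev_evolveFun, ev_add, mul_add]
  commutes' c := by
    ext g ρ
    rw [ev_evolveFun, Algebra.algebraMap_eq_smul_one, ev_smul, ev_one]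
    split_ifs with h
    · rw [h.1, detPow_one, one_mul]
    · simp
  map_star' f := by
    ext g ρ
    rw [ev_evolveFun, ev_star, ev_star, ev_evolveFun, map_mul, conj_detPow]

end CcG2

/-! ### The groupoid `C*`-algebra -/

/-- An involutive representation of `C_c(G₂)` by bounded operators in a Hilbert space. -/
structure Rep where
  H : Type
  [normed : NormedAddCommGroup H]
  [innerProd : InnerProductSpace ℂ H]
  [complete : CompleteSpace H]
  [nontriv : Nontrivial H]
  hom : CcG2 →⋆ₐ[ℂ] (H →L[ℂ] H)

attribute [instance] Rep.normed Rep.innerProd Rep.complete Rep.nontriv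

namespace CcG2

open Classical in
theorem ev_star_mul_self (a : CcG2) (g : GQ) (ha : ∀ h ρ, h ≠ g → ev a h ρ = 0) (r : GQ)
    (ρ : MAf) : ev (star a * a) r ρ =
      if r = 1 then (starRingEnd ℂ) (ev a g ρ) * ev a g ρ else 0 := by
  rw [ev_mul, conv, finsum_eq_single _ g]
  · rw [ev_star, ← act_mul]
    split_ifs with h
    · rw [h, one_mul, inv_inv, inv_mul_cancel, act_one]
    · rw [ha _ _ (fun h' => h ?_), map_zero, zero_mul]
      simpa using h'
  · intro s hs
    rw [ha s ρ hs, mul_zero]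

open Classical in
/-- The restriction of `f` to the slice over `g`. -/
def restr (f : CcG2) (g : GQ) : CcG2 :=
  mk (fun h ρ => if h = g then ev f g ρ else 0)
    (fun h => by
      by_cases hg : h = g
      · simpa only [hg, if_true] using continuous_ev f g
      · simpa only [hg, if_false] using continuous_const)
    {g} (Set.finite_singleton g) (fun _ hg _ _ => if_neg hg)

open Classical in
theorem ev_restr (f : CcG2) (g h : GQ) (ρ : MAf) :
    ev (restr f g) h ρ = if h = g then ev f g ρ else 0 := by
  refine ev_mk' (fun h ρ hρ => ?_) h ρ
  split_ifs with hg
  · exact ev_of_not f (hg ▸ hρ)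
  · rfl

theorem sum_restr (f : CcG2) : f = ∑ g ∈ gsupp f, restr f g := by
  classical
  ext h ρ
  rw [ev_sum]
  simp only [ev_restr]
  rw [Finset.sum_ite_eq]
  split_ifs with hh
  · rfl
  · exact ev_of_notMem hh ρ

theorem exists_bound (f : CcG2) (g : GQ) : ∃ C, 0 ≤ C ∧ ∀ ρ, ‖ev f g ρ‖ ≤ C := by
  obtain ⟨C, hC⟩ := (isCompact_dom g).exists_bound_of_continuousOn (continuous_ev f g).continuousOn
  refine ⟨max C 0, le_max_right _ _, fun ρ => ?_⟩
  by_cases h : ρ ∈ dom g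
  · exact (hC ρ h).trans (le_max_left _ _)
  · rw [ev_of_not f h, norm_zero]; exact le_max_right _ _

open Classical in
/-- A continuous function on `M₂(R)` as an element of `C_c(G₂)` supported by the units. -/
def diag (φ : MAf → ℂ) (hφ : Continuous φ) : CcG2 :=
  mk (fun h ρ => if h = 1 then φ ρ else 0)
    (fun h => by
      by_cases hg : h = 1
      · simpa only [hg, if_true] using hφ
      · simpa only [hg, if_false] using continuous_const)
    {1} (Set.finite_singleton 1) (fun _ hg _ _ => if_neg hg)

open Classical in
theorem ev_diag (φ : MAf → ℂ) (hφ : Continuous φ) (g : GQ) (ρ : MAf) :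
    ev (diag φ hφ) g ρ = if g = 1 ∧ ρ ∈ MR then φ ρ else 0 := by
  by_cases h : ρ ∈ dom g
  · have : ev (diag φ hφ) g ρ = if g = 1 then φ ρ else 0 := ev_mk h
    rw [this]
    simp [h.1]
  · rw [ev_of_not _ h, if_neg]
    rintro ⟨rfl, h2⟩
    exact h ⟨h2, by rwa [Set.mem_preimage, act_one]⟩

theorem exists_defect (f : CcG2) (g : GQ) (C : ℝ) (hC : ∀ ρ, ‖ev f g ρ‖ ≤ C) :
    ∃ k : CcG2, star (restr f g) * restr f g + star k * k = ((C : ℂ) ^ 2) • (1 : CcG2) := by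
  classical
  have hcont : Continuous fun ρ : MAf => ((Real.sqrt (C ^ 2 - ‖ev f g ρ‖ ^ 2) : ℝ) : ℂ) := by
    have := continuous_ev f g
    fun_prop
  refine ⟨diag _ hcont, ?_⟩
  ext r ρ
  rw [ev_add, ev_star_mul_self _ g (fun h ρ hh => by rw [ev_restr, if_neg hh]),
    ev_star_mul_self _ 1 (fun h ρ hh => by rw [ev_diag, if_neg (fun h' => hh h'.1)]), ev_smul,
    ev_one, ev_restr, if_pos rfl, ev_diag]
  by_cases hr : r = 1
  · simp only [hr, if_true, true_and]
    by_cases hρ : ρ ∈ MR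
    · simp only [hρ, if_true]
      rw [Complex.conj_ofReal, ← Complex.ofReal_mul, Real.mul_self_sqrt,
        ← Complex.normSq_eq_conj_mul_self, Complex.normSq_eq_norm_sq]
      · push_cast; ring
      · have := hC ρ
        have h0 := norm_nonneg (ev f g ρ)
        nlinarith
    · rw [ev_of_not f (fun h => hρ h.1)]
      simp [hρ]
  · simp [hr]

theorem norm_hom_restr_le (R : Rep) (f : CcG2) (g : GQ) (C : ℝ) (h0 : 0 ≤ C)
    (hC : ∀ ρ, ‖ev f g ρ‖ ≤ C) : ‖R.hom (restr f g)‖ ≤ C := by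
  obtain ⟨k, hk⟩ := exists_defect f g C hC
  have h1 : star (R.hom (restr f g)) * R.hom (restr f g) + star (R.hom k) * R.hom k =
      ((C : ℂ) ^ 2) • (1 : R.H →L[ℂ] R.H) := by
    rw [← map_star, ← map_star, ← map_mul, ← map_mul, ← map_add, hk, map_smul, map_one]
  refine ContinuousLinearMap.opNorm_le_bound _ h0 fun x => ?_
  have h2 := congrArg (fun T : R.H →L[ℂ] R.H => RCLike.re (inner ℂ (T x) x)) h1
  simp only [add_apply, inner_add_left, map_add] at h2
  have h3 := ContinuousLinearMap.apply_norm_sq_eq_inner_adjoint_left (R.hom (restr f g)) x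
  have h4 := ContinuousLinearMap.apply_norm_sq_eq_inner_adjoint_left (R.hom k) x
  have h5 : RCLike.re (inner ℂ ((((C : ℂ) ^ 2) • (1 : R.H →L[ℂ] R.H)) x) x) = C ^ 2 * ‖x‖ ^ 2 := by
    rw [smul_apply, one_apply_eq_self, inner_smul_left,
      inner_self_eq_norm_sq_to_K, map_pow, Complex.conj_ofReal]
    have : ((C : ℂ) ^ 2 * ((‖x‖ : ℝ) : ℂ) ^ 2) = ((C ^ 2 * ‖x‖ ^ 2 : ℝ) : ℂ) := by push_cast; rfl
    exact (congrArg Complex.re this).trans (Complex.ofReal_re _)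
  rw [h5] at h2
  have h6 := sq_nonneg ‖R.hom k x‖
  have h7 : ‖R.hom (restr f g) x‖ ^ 2 + ‖R.hom k x‖ ^ 2 = C ^ 2 * ‖x‖ ^ 2 := by
    rw [h3, h4]; exact h2
  refine abs_le_of_sq_le_sq' ?_ (by positivity) |>.2
  rw [mul_pow]
  linarith

theorem exists_norm_hom_le (f : CcG2) : ∃ C, ∀ R : Rep, ‖R.hom f‖ ≤ C := by
  choose C h0 hC using exists_bound f
  refine ⟨∑ g ∈ gsupp f, C g, fun R => ?_⟩
  conv_lhs => rw [sum_restr f, map_sum]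
  exact (norm_sum_le _ _).trans (Finset.sum_le_sum fun g _ =>
    norm_hom_restr_le R f g (C g) (h0 g) (hC g))

end CcG2

/-- The `C*`-algebra of bounded families of operators, one for each representation of `C_c(G₂)`. -/
abbrev Univ : Type 1 := lp (fun R : Rep => R.H →L[ℂ] R.H) ∞

instance : StarModule ℂ Univ := inferInstance
instance : IsTopologicalRing Univ := inferInstance
instance : IsSemitopologicalSemiring Univ := inferInstance
instance : ContinuousStar Univ := inferInstance

/-- The universal representation of `C_c(G₂)`. -/
def univRep : CcG2 →⋆ₐ[ℂ] Univ where
  toFun f := ⟨fun R => R.hom f, by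
    obtain ⟨C, hC⟩ := CcG2.exists_norm_hom_le f
    exact memℓp_infty ⟨C, by rintro _ ⟨R, rfl⟩; exact hC R⟩⟩
  map_one' := lp.ext (funext fun R => map_one R.hom)
  map_mul' f f' := lp.ext (funext fun R => map_mul R.hom f f')
  map_zero' := lp.ext (funext fun R => map_zero R.hom)
  map_add' f f' := lp.ext (funext fun R => map_add R.hom f f')
  commutes' c := lp.ext (funext fun R => AlgHomClass.commutes R.hom c)
  map_star' f := lp.ext (funext fun R => map_star R.hom f)

/-- The `C*`-algebra `A = C*(G₂) = C(M₂(R)) ⋊ M₂(ℤ)⁺`: the completion of `C_c(G₂)` in the norm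
`‖f‖ = sup ‖π(f)‖` over all involutive representations `π`. -/
def groupoidCStar : StarSubalgebra ℂ Univ := univRep.range.topologicalClosure

/-- The composition of a representation with the time evolution. -/
def Rep.twist (R : Rep) (t : ℝ) : Rep where
  H := R.H
  hom := R.hom.comp (CcG2.evolve t)

/-- The time evolution extended from `C_c(G₂)`: the coordinate of `σ_t(a)` at the representation
`π` is the coordinate of `a` at `π ∘ σ_t`. -/
def evolveUniv (t : ℝ) : Univ →⋆ₐ[ℂ] Univ where
  toFun a := ⟨fun R => a.1 (R.twist t), memℓp_infty <| by
    obtain ⟨C, hC⟩ := (lp.memℓp a).bddAbove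
    refine ⟨C, ?_⟩
    rintro _ ⟨R, rfl⟩
    exact hC ⟨R.twist t, rfl⟩⟩
  map_one' := rfl
  map_mul' _ _ := rfl
  map_zero' := rfl
  map_add' _ _ := rfl
  commutes' _ := rfl
  map_star' _ := rfl

theorem evolveUniv_univRep (t : ℝ) (f : CcG2) :
    evolveUniv t (univRep f) = univRep (CcG2.evolve t f) := rfl

/-! ### Weighted partial permutation operators on `ℓ²` -/

section Ell2

variable {M X : Type}

/-- The Hilbert space `ℓ²(M)`. -/
abbrev Ell2 (M : Type) : Type := lp (fun _ : M => ℂ) 2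

open Classical in
/-- The canonical basis vector `ε_m` of `ℓ²(M)`. -/
def basisVec (m : M) : Ell2 M := lp.single 2 m 1

open Classical in
theorem basisVec_apply (m n : M) : basisVec m n = if n = m then 1 else 0 := by
  rw [basisVec, lp.single_apply]
  by_cases h : n = m
  · subst h; simp
  · simp [h]

theorem sum_wop_le (ι e : M → X) (hι : Function.Injective ι) (he : Function.Injective e)
    (w : M → ℂ) (C : ℝ) (h0 : 0 ≤ C) (hC : ∀ n, ‖w n‖ ≤ C) (ξ : Ell2 M) (s : Finset M) :
    ∑ n ∈ s, ‖w n * Function.extend ι ξ 0 (e n)‖ ^ (2 : ℝ≥0∞).toReal ≤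
      (C * ‖ξ‖) ^ (2 : ℝ≥0∞).toReal := by
  classical
  have hsum := lp.hasSum_norm (p := 2) (by simp) ξ
  have hext : HasSum (fun x => ‖Function.extend ι ξ 0 x‖ ^ (2 : ℝ≥0∞).toReal)
      (‖ξ‖ ^ (2 : ℝ≥0∞).toReal) := by
    rw [← hι.hasSum_iff]
    · convert hsum using 2 with m
      simp [hι.extend_apply]
    · intro x hx
      rw [Function.extend_apply' _ _ _ (by simpa using hx)]
      simp
  rw [Real.mul_rpow h0 (norm_nonneg _)]
  calc ∑ n ∈ s, ‖w n * Function.extend ι ξ 0 (e n)‖ ^ (2 : ℝ≥0∞).toReal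
      ≤ ∑ n ∈ s, C ^ (2 : ℝ≥0∞).toReal *
          ‖Function.extend ι ξ 0 (e n)‖ ^ (2 : ℝ≥0∞).toReal := by
        refine Finset.sum_le_sum fun n _ => ?_
        rw [norm_mul, Real.mul_rpow (norm_nonneg _) (norm_nonneg _)]
        gcongr
        exact hC n
    _ = C ^ (2 : ℝ≥0∞).toReal *
          ∑ x ∈ s.image e, ‖Function.extend ι ξ 0 x‖ ^ (2 : ℝ≥0∞).toReal := by
        rw [Finset.sum_image fun _ _ _ _ h => he h, Finset.mul_sum]
    _ ≤ _ := by
        gcongr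
        exact sum_le_hasSum _ (fun _ _ => by positivity) hext

/-- For injective `ι, e : M → X` and a bounded weight `w`, the operator
`(T ξ)(n) = w(n) ξ(ι⁻¹(e(n)))`, where `ξ(ι⁻¹(x)) = 0` if `x` is not in the range of `ι`. -/
def wop (ι e : M → X) (hι : Function.Injective ι) (he : Function.Injective e)
    (w : M → ℂ) (C : ℝ) (h0 : 0 ≤ C) (hC : ∀ n, ‖w n‖ ≤ C) : Ell2 M →L[ℂ] Ell2 M :=
  LinearMap.mkContinuous
    { toFun := fun ξ => ⟨fun n => w n * Function.extend ι ξ 0 (e n),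
        memℓp_gen' (sum_wop_le ι e hι he w C h0 hC ξ)⟩
      map_add' := fun ξ η => by
        ext n
        change w n * Function.extend ι (fun m => ξ m + η m) 0 (e n) =
          w n * Function.extend ι ξ 0 (e n) + w n * Function.extend ι η 0 (e n)
        rw [← mul_add]
        congr 1
        by_cases h : ∃ m, ι m = e n
        · obtain ⟨m, hm⟩ := h
          rw [← hm, hι.extend_apply, hι.extend_apply, hι.extend_apply]
        · simp [Function.extend_apply' _ _ _ h]
      map_smul' := fun c ξ => by
        ext n
        change w n * Function.extend ι (fun m => c * ξ m) 0 (e n) =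
          c * (w n * Function.extend ι ξ 0 (e n))
        by_cases h : ∃ m, ι m = e n
        · obtain ⟨m, hm⟩ := h
          rw [← hm, hι.extend_apply, hι.extend_apply]
          ring
        · simp [Function.extend_apply' _ _ _ h] }
    C (fun ξ => lp.norm_le_of_forall_sum_le (by simp) (by positivity)
      (sum_wop_le ι e hι he w C h0 hC ξ))

open Classical in
theorem wop_basisVec (ι e : M → X) (hι : Function.Injective ι) (he : Function.Injective e)
    (w : M → ℂ) (C : ℝ) (h0 : 0 ≤ C) (hC : ∀ n, ‖w n‖ ≤ C) (m n : M) :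
    wop ι e hι he w C h0 hC (basisVec m) n = if e n = ι m then w n else 0 := by
  change w n * Function.extend ι (basisVec m) 0 (e n) = _
  by_cases h : ∃ l, ι l = e n
  · obtain ⟨l, hl⟩ := h
    rw [← hl, hι.extend_apply, basisVec_apply]
    simp [hι.eq_iff]
  · rw [Function.extend_apply' _ _ _ h, if_neg (fun h' => h ⟨m, h'.symm⟩)]
    simp

theorem op_apply (T : Ell2 M →L[ℂ] Ell2 M) (ξ : Ell2 M) (n : M) :
    HasSum (fun m => T (basisVec m) n * ξ m) (T ξ n) := by
  classical
  have h := lp.hasSum_single (p := 2) (by simp) ξ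
  have h2 := (h.mapL T)
  have h3 := h2.mapL (lp.evalCLM ℂ (fun _ : M => ℂ) 2 n)
  have h4 : (fun m => T (basisVec m) n * ξ m) =
      fun m => lp.evalCLM ℂ (fun _ : M => ℂ) 2 n (T (lp.single 2 m (ξ m))) := by
    funext m
    have : (lp.single 2 m (ξ m) : Ell2 M) = ξ m • basisVec m := by
      have h5 := lp.single_smul (E := fun _ : M => ℂ) 2 m (ξ m) (1 : ℂ)
      rw [smul_eq_mul, mul_one] at h5
      rw [h5, basisVec]
    rw [this, map_smul, mul_comm]
    rfl
  rw [h4]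
  exact h3

theorem op_ext {T S : Ell2 M →L[ℂ] Ell2 M} (h : ∀ m n, T (basisVec m) n = S (basisVec m) n) :
    T = S := by
  ext ξ n
  refine (op_apply T ξ n).unique ?_
  simp only [h]
  exact op_apply S ξ n

theorem inner_basisVec (m : M) (ξ : Ell2 M) : inner ℂ (basisVec m) ξ = ξ m := by
  classical
  rw [basisVec, lp.inner_single_left]
  simp

theorem star_op_apply (T : Ell2 M →L[ℂ] Ell2 M) (m n : M) :
    (star T) (basisVec m) n = (starRingEnd ℂ) (T (basisVec n) m) := by
  rw [← inner_basisVec, ContinuousLinearMap.star_eq_adjoint, ContinuousLinearMap.adjoint_inner_right,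
    ← inner_conj_symm, inner_basisVec]

instance [Nonempty M] : Nontrivial (Ell2 M) := by
  classical
  obtain ⟨m⟩ := ‹Nonempty M›
  refine ⟨basisVec m, 0, fun h => ?_⟩
  have := congrArg (fun ξ : Ell2 M => ξ m) h
  simp [basisVec_apply] at this

end Ell2

/-! ### The semigroup `M₂(ℤ)⁺` and its representation -/

/-- The semigroup `M₂(ℤ)⁺` of integral matrices of positive determinant. -/
def M2Z : Type := {m : Matrix (Fin 2) (Fin 2) ℤ // 0 < m.det}

namespace M2Z

/-- The underlying integral matrix. -/
def mat (m : M2Z) : Matrix (Fin 2) (Fin 2) ℤ := m.1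

theorem mat_injective : Function.Injective mat := Subtype.val_injective

instance : Nonempty M2Z := ⟨⟨1, by simp⟩⟩

/-- The determinant, as a real number. -/
def det (m : M2Z) : ℝ := (m.mat.det : ℤ)

theorem one_le_det (m : M2Z) : 1 ≤ m.det := by
  have h : 0 < m.mat.det := m.2
  have h' : (1 : ℤ) ≤ m.mat.det := h
  exact (Int.cast_one (R := ℝ)).symm.le.trans (Int.cast_le.2 h')

/-- The inclusion `M₂(ℤ)⁺ → GL₂⁺(ℚ)`. -/
def toGQ (m : M2Z) : GQ :=
  ⟨Matrix.GeneralLinearGroup.mkOfDetNeZero (m.mat.map (Int.cast : ℤ → ℚ)) (by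
      have h : 0 < m.mat.det := m.2
      have h2 : (m.mat.map (Int.cast : ℤ → ℚ)).det = (m.mat.det : ℚ) :=
        ((Int.castRingHom ℚ).map_det m.mat).symm
      rw [h2]
      exact_mod_cast h.ne'), by
    have h : 0 < m.mat.det := m.2
    have h2 : (m.mat.map (Int.cast : ℤ → ℚ)).det = (m.mat.det : ℚ) :=
      ((Int.castRingHom ℚ).map_det m.mat).symm
    change 0 < (m.mat.map (Int.cast : ℤ → ℚ)).det
    rw [h2]
    exact_mod_cast h⟩

theorem mat_toGQ (m : M2Z) : GQ.mat m.toGQ = m.mat.map (Int.cast : ℤ → ℚ) := rfl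

theorem toGQ_injective : Function.Injective toGQ := by
  intro m n h
  apply mat_injective
  have h2 : m.mat.map (Int.cast : ℤ → ℚ) = n.mat.map (Int.cast : ℤ → ℚ) := by
    rw [← mat_toGQ, ← mat_toGQ, h]
  exact Matrix.map_injective Int.cast_injective h2

end M2Z

theorem algebraMap_mem_Zhat (q : ℚ) : algebraMap ℚ Af q ∈ Zhat ↔ ∃ n : ℤ, (n : ℚ) = q := by
  have h : ∀ v : IsDedekindDomain.HeightOneSpectrum ℤ,
      (algebraMap ℚ Af q) v ∈ v.adicCompletionIntegers ℚ ↔ v.valuation ℚ q ≤ 1 := by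
    intro v
    rw [IsDedekindDomain.FiniteAdeleRing.algebraMap_apply,
      IsDedekindDomain.HeightOneSpectrum.mem_adicCompletionIntegers,
      IsDedekindDomain.HeightOneSpectrum.valuedAdicCompletion_eq_valuation']
  constructor
  · intro hq
    obtain ⟨n, hn⟩ := IsDedekindDomain.HeightOneSpectrum.mem_integers_of_valuation_le_one
      (R := ℤ) ℚ q fun v => (h v).1 (hq v)
    exact ⟨n, by simpa using hn⟩
  · rintro ⟨n, rfl⟩ v
    exact (h v).2 (by simpa using v.valuation_le_one (K := ℚ) n)

theorem one_mem_MR : (1 : MAf) ∈ MR := by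
  intro i j
  rw [Matrix.one_apply]
  split_ifs
  · exact one_mem _
  · exact zero_mem _

theorem mul_mem_MR {ρ σ : MAf} (h : ρ ∈ MR) (h' : σ ∈ MR) : ρ * σ ∈ MR := fun i j => by
  rw [Matrix.mul_apply]
  exact sum_mem fun k _ => mul_mem (h i k) (h' k j)

theorem emb_int_mem (m : Matrix (Fin 2) (Fin 2) ℤ) : emb (m.map (Int.cast : ℤ → ℚ)) ∈ MR :=
  fun i j => (algebraMap_mem_Zhat _).2 ⟨m i j, rfl⟩

theorem act_one_mem (g : GQ) : act g 1 ∈ MR ↔ g ∈ Set.range M2Z.toGQ := by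
  constructor
  · intro h
    rw [act, mul_one] at h
    choose n hn using fun i j => (algebraMap_mem_Zhat (GQ.mat g i j)).1 (h i j)
    have h2 : (Matrix.of n).map (Int.cast : ℤ → ℚ) = GQ.mat g := by
      ext i j; exact hn i j
    have h3 : 0 < (Matrix.of n).det := by
      have h4 : ((Matrix.of n).map (Int.cast : ℤ → ℚ)).det = ((Matrix.of n).det : ℚ) :=
        ((Int.castRingHom ℚ).map_det (Matrix.of n)).symm
      have h5 : 0 < (GQ.mat g).det := g.2
      rw [← h2, h4] at h5
      exact_mod_cast h5
    refine ⟨⟨Matrix.of n, h3⟩, ?_⟩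
    apply Subtype.ext
    apply Units.ext
    exact h2
  · rintro ⟨m, rfl⟩
    rw [act, mul_one]
    exact emb_int_mem m.mat

theorem act_M2Z_mem (m : M2Z) {σ : MAf} (h : σ ∈ MR) : act m.toGQ σ ∈ MR :=
  mul_mem_MR (emb_int_mem m.mat) h

/-- The Hilbert space `ℋ = ℓ²(M₂(ℤ)⁺)`. -/
abbrev HS : Type := Ell2 M2Z

namespace CcG2

/-- The matrix coefficients `f(n m⁻¹, m)`, for `n, m ∈ GL₂⁺(ℚ)`. -/
def coef (f : CcG2) (n m : GQ) : ℂ := ev f (n * m⁻¹) (act m 1)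

theorem coef_ne_zero {f : CcG2} {n m : GQ} (h : coef f n m ≠ 0) :
    n ∈ Set.range M2Z.toGQ ∧ m ∈ Set.range M2Z.toGQ := by
  by_cases hd : act m 1 ∈ dom (n * m⁻¹)
  · have h2 := hd.2
    rw [Set.mem_preimage, ← act_mul, inv_mul_cancel_right] at h2
    exact ⟨(act_one_mem n).1 h2, (act_one_mem m).1 hd.1⟩
  · exact absurd (ev_of_not f hd) h

theorem coef_mul (f f' : CcG2) (n m : M2Z) :
    coef (f * f') n.toGQ m.toGQ =
      ∑' l : M2Z, coef f n.toGQ l.toGQ * coef f' l.toGQ m.toGQ := by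
  have h1 : ∑' l : M2Z, coef f n.toGQ l.toGQ * coef f' l.toGQ m.toGQ =
      ∑' l : GQ, coef f n.toGQ l * coef f' l m.toGQ :=
    M2Z.toGQ_injective.tsum_eq (f := fun l => coef f n.toGQ l * coef f' l m.toGQ)
      fun l hl => (coef_ne_zero (right_ne_zero_of_mul hl)).1
  rw [h1, tsum_eq_finsum, ← finsum_comp_equiv (Equiv.mulRight m.toGQ)]
  · rw [coef, ev_mul, conv]
    refine finsum_congr fun s => ?_
    simp only [Equiv.coe_mulRight, coef, mul_inv_cancel_right]
    simp only [mul_inv_rev, act_mul, mul_assoc]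
  · refine ((gsupp f').finite_toSet.image (fun t => t * m.toGQ)).subset fun l hl => ?_
    exact ⟨_, mem_gsupp (right_ne_zero_of_mul hl), inv_mul_cancel_right l _⟩

/-- The contribution of the slice over `g` to the operator of `f` in `ℓ²(M₂(ℤ)⁺)`. -/
def regSlice (f : CcG2) (g : GQ) : HS →L[ℂ] HS :=
  wop M2Z.toGQ (fun n => g⁻¹ * n.toGQ) M2Z.toGQ_injective
    (fun _ _ h => M2Z.toGQ_injective (mul_left_cancel h))
    (fun n => ev f g (act (g⁻¹ * n.toGQ) 1)) (exists_bound f g).choose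
    (exists_bound f g).choose_spec.1 (fun _ => (exists_bound f g).choose_spec.2 _)

/-- The operator `(π(f) ξ)(n) = ∑_m f(n m⁻¹, m) ξ(m)` in `ℓ²(M₂(ℤ)⁺)`. -/
def regOp (f : CcG2) : HS →L[ℂ] HS := ∑ g ∈ gsupp f, regSlice f g

theorem regOp_basisVec (f : CcG2) (m n : M2Z) :
    regOp f (basisVec m) n = coef f n.toGQ m.toGQ := by
  classical
  have h : regOp f (basisVec m) n = ∑ g ∈ gsupp f, regSlice f g (basisVec m) n := by
    rw [regOp, sum_apply, lp.coeFn_sum, Finset.sum_apply]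
  rw [h]
  have h2 : ∀ g : GQ, (g⁻¹ * n.toGQ = m.toGQ) ↔ g = n.toGQ * m.toGQ⁻¹ := by
    intro g
    constructor
    · intro h; rw [← h]; group
    · rintro rfl; group
  have h4 : ∀ g ∈ gsupp f, regSlice f g (basisVec m) n =
      if g = n.toGQ * m.toGQ⁻¹ then ev f g (act (g⁻¹ * n.toGQ) 1) else 0 := by
    intro g _
    refine (wop_basisVec _ _ _ _ _ _ _ _ m n).trans ?_
    by_cases h5 : g⁻¹ * n.toGQ = m.toGQ
    · rw [if_pos h5, if_pos ((h2 g).1 h5)]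
    · rw [if_neg h5, if_neg (fun h6 => h5 ((h2 g).2 h6))]
  rw [Finset.sum_congr rfl h4, Finset.sum_ite_eq']
  split_ifs with h3
  · rw [coef]; congr 2; group
  · exact (ev_of_notMem h3 _).symm

end CcG2

open CcG2

/-- The involutive representation `(π(f) ξ)(n) = ∑_m f(n m⁻¹, m) ξ(m)` of `C_c(G₂)` in
`ℓ²(M₂(ℤ)⁺)`. -/
def regHom : CcG2 →⋆ₐ[ℂ] (HS →L[ℂ] HS) where
  toFun := regOp
  map_one' := by
    classical
    refine op_ext fun m n => ?_
    rw [regOp_basisVec, one_apply_eq_self, basisVec_apply, coef, ev_one]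
    simp only [mul_inv_eq_one, M2Z.toGQ_injective.eq_iff, (act_one_mem _).2 ⟨m, rfl⟩, and_true]
  map_mul' f f' := by
    refine op_ext fun m n => ?_
    rw [regOp_basisVec, mul_apply_eq_comp, coef_mul]
    rw [← (op_apply (regOp f) (regOp f' (basisVec m)) n).tsum_eq]
    simp only [regOp_basisVec]
  map_zero' := by
    refine op_ext fun m n => ?_
    rw [regOp_basisVec, coef, ev_zero]
    rfl
  map_add' f f' := by
    refine op_ext fun m n => ?_
    rw [regOp_basisVec, coef, ev_add]
    change _ = regOp f (basisVec m) n + regOp f' (basisVec m) n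
    rw [regOp_basisVec, regOp_basisVec]
    rfl
  commutes' c := by
    classical
    refine op_ext fun m n => ?_
    rw [regOp_basisVec, Algebra.algebraMap_eq_smul_one, Algebra.algebraMap_eq_smul_one, coef,
      ev_smul, ev_one]
    change _ = c * basisVec m n
    rw [basisVec_apply]
    simp only [mul_inv_eq_one, M2Z.toGQ_injective.eq_iff, (act_one_mem _).2 ⟨m, rfl⟩, and_true]
  map_star' f := by
    refine op_ext fun m n => ?_
    rw [regOp_basisVec, star_op_apply, regOp_basisVec, coef, coef, ev_star, ← act_mul]
    simp

/-- `ℓ²(M₂(ℤ)⁺)` as a representation of `C_c(G₂)`. -/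
def regRep : Rep where
  H := HS
  hom := regHom

/-- The extension of the representation in `ℓ²(M₂(ℤ)⁺)` from `C_c(G₂)` to the completion. -/
def regUniv : Univ →⋆ₐ[ℂ] (HS →L[ℂ] HS) where
  toFun a := a.1 regRep
  map_one' := rfl
  map_mul' _ _ := rfl
  map_zero' := rfl
  map_add' _ _ := rfl
  commutes' _ := rfl
  map_star' _ := rfl

theorem regUniv_univRep (f : CcG2) : regUniv (univRep f) = regHom f := rfl

/-! ### The partial isometries `μ(g, L)` and the algebra they generate -/

/-- The image `m(ℤ²)` of the matrix `m`. -/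
def M2Z.lattice (m : M2Z) : AddSubgroup (Fin 2 → ℤ) := m.mat.mulVecLin.toAddMonoidHom.range

/-- For a lattice `L ⊆ ℤ²`, the subset `P_L = m M₂(R)` of `M₂(R)`, where `m(ℤ²) = L`. -/
def latticeSet (L : AddSubgroup (Fin 2 → ℤ)) : Set MAf :=
  {ρ | ∃ m : M2Z, m.lattice = L ∧ ∃ σ ∈ MR, ρ = act m.toGQ σ}

theorem act_mem_of_lattice_le {m n : M2Z} (h : m.lattice ≤ n.lattice) {σ : MAf} (hσ : σ ∈ MR) :
    ∃ τ ∈ MR, act m.toGQ σ = act n.toGQ τ := by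
  have h1 : ∀ j, ∃ v : Fin 2 → ℤ, n.mat.mulVec v = fun i => m.mat i j := by
    intro j
    have h2 : (fun i => m.mat i j) ∈ m.lattice := ⟨Pi.single j 1, by
      change m.mat.mulVec (Pi.single j 1) = _
      simp [Matrix.col]
      rfl⟩
    obtain ⟨v, hv⟩ := h h2
    exact ⟨v, hv⟩
  choose v hv using h1
  have h3 : m.mat = n.mat * Matrix.of fun i j => v j i := by
    ext i j
    exact (congrFun (hv j) i).symm
  refine ⟨emb ((Matrix.of fun i j => v j i).map (Int.cast : ℤ → ℚ)) * σ,
    mul_mem_MR (emb_int_mem _) hσ, ?_⟩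
  rw [act, act, M2Z.mat_toGQ, M2Z.mat_toGQ, ← Matrix.mul_assoc]
  congr 1
  rw [h3]
  simp only [emb]
  rw [← Matrix.map_mul (f := algebraMap ℚ Af)]
  congr 1
  exact Matrix.map_mul (f := Int.castRingHom ℚ)

theorem latticeSet_subset (L : AddSubgroup (Fin 2 → ℤ)) : latticeSet L ⊆ MR := by
  rintro _ ⟨m, -, σ, hσ, rfl⟩
  exact act_M2Z_mem m hσ

theorem latticeSet_lattice (m : M2Z) : latticeSet m.lattice = act m.toGQ⁻¹ ⁻¹' MR := by
  ext ρ
  constructor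
  · rintro ⟨n, hn, σ, hσ, rfl⟩
    obtain ⟨τ, hτ, h⟩ := act_mem_of_lattice_le hn.le hσ
    rw [h, Set.mem_preimage, ← act_mul, inv_mul_cancel, act_one]
    exact hτ
  · intro h
    exact ⟨m, rfl, _, h, by rw [← act_mul, mul_inv_cancel, act_one]⟩

theorem isClopen_latticeSet (L : AddSubgroup (Fin 2 → ℤ)) : IsClopen (latticeSet L) := by
  by_cases h : ∃ m : M2Z, m.lattice = L
  · obtain ⟨m, rfl⟩ := h
    rw [latticeSet_lattice]
    exact isClopen_MR.preimage (continuous_act _)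
  · have : latticeSet L = ∅ := by
      ext ρ
      refine ⟨?_, fun h => h.elim⟩
      rintro ⟨m, hm, -⟩
      exact h ⟨m, hm⟩
    rw [this]
    exact isClopen_empty

/-- The projection `π_L`, the characteristic function of `P_L`. -/
def latticeProj (L : AddSubgroup (Fin 2 → ℤ)) : MAf → ℂ := (latticeSet L).indicator fun _ => 1

open Classical in
/-- The function `μ(g, L)` on `G₂`: `μ(g, L)(g, ρ) = π_L(ρ)` and `μ(g, L)(r, ρ) = 0` for
`r ≠ g`. -/
def mu (g : GQ) (L : AddSubgroup (Fin 2 → ℤ)) : CcG2 :=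
  CcG2.mk (fun r ρ => if r = g then latticeProj L ρ else 0)
    (fun r => by
      by_cases hr : r = g
      · simp only [hr, if_true]
        exact (isClopen_latticeSet L).continuous_indicator continuous_const
      · simpa only [hr, if_false] using continuous_const)
    {g} (Set.finite_singleton g) (fun _ hr _ _ => if_neg hr)

/-- The pairs `(g, L)` with `L ⊆ ℤ²` a lattice and `g(L) ⊆ ℤ²`. -/
def IsAdmissible (g : GQ) (L : AddSubgroup (Fin 2 → ℤ)) : Prop :=
  L.FiniteIndex ∧ ∀ v ∈ L, ∃ w : Fin 2 → ℤ, (GQ.mat g).mulVec (fun i => (v i : ℚ)) = fun i => (w i : ℚ)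

/-- The generators `μ(g, L)` of `C*(M₂(ℤ)⁺)`. -/
def generators : Set Univ := {a | ∃ g L, IsAdmissible g L ∧ a = univRep (mu g L)}

/-- The `C*`-algebra `C*(M₂(ℤ)⁺) ⊆ A` generated by the `μ(g, L)`. -/
def semigroupCStar : StarSubalgebra ℂ Univ :=
  (StarAlgebra.adjoin ℂ generators).topologicalClosure

theorem semigroupCStar_le : semigroupCStar ≤ groupoidCStar := by
  refine StarSubalgebra.topologicalClosure_mono (StarAlgebra.adjoin_le ?_)
  rintro _ ⟨g, L, -, rfl⟩
  exact ⟨_, rfl⟩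

theorem evolve_mu (t : ℝ) (g : GQ) (L : AddSubgroup (Fin 2 → ℤ)) :
    CcG2.evolve t (mu g L) = detPow t g • mu g L := by
  classical
  ext r ρ
  change ev (evolveFun t (mu g L)) r ρ = _
  rw [ev_evolveFun, ev_smul]
  by_cases h : r = g
  · rw [h]
  · have : ev (mu g L) r ρ = 0 := by
      by_cases hd : ρ ∈ dom r
      · exact (ev_mk hd).trans (if_neg h)
      · exact ev_of_not _ hd
    rw [this, mul_zero, mul_zero]

theorem continuous_evolveUniv (t : ℝ) : Continuous (evolveUniv t) := by
  refine (LipschitzWith.of_dist_le_mul (K := 1) fun a b => ?_).continuous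
  rw [dist_eq_norm, dist_eq_norm, ← map_sub, NNReal.coe_one, one_mul]
  exact lp.norm_le_of_forall_le (norm_nonneg _) fun R =>
    lp.norm_apply_le_norm (by simp) (a - b) (R.twist t)

theorem evolveUniv_mem (t : ℝ) {a : Univ} (ha : a ∈ semigroupCStar) :
    evolveUniv t a ∈ semigroupCStar := by
  have h : StarAlgebra.adjoin ℂ generators ≤
      (StarAlgebra.adjoin ℂ generators).comap
        (evolveUniv t) := by
    refine StarAlgebra.adjoin_le ?_
    rintro _ ⟨g, L, hg, rfl⟩
    change evolveUniv t (univRep (mu g L)) ∈ StarAlgebra.adjoin ℂ generators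
    rw [evolveUniv_univRep, evolve_mu, map_smul]
    exact (StarAlgebra.adjoin ℂ generators).toSubalgebra.smul_mem
      (StarAlgebra.subset_adjoin ℂ generators ⟨g, L, hg, rfl⟩) (detPow t g)
  exact map_mem_closure (s := (StarAlgebra.adjoin ℂ generators : Set Univ))
    (continuous_evolveUniv t) ha fun x hx => h hx

/-- The time evolution `σ_t` of `C*(M₂(ℤ)⁺)`. -/
def sigma (t : ℝ) : semigroupCStar →⋆ₐ[ℂ] semigroupCStar :=
  ((evolveUniv t).comp semigroupCStar.subtype).codRestrict semigroupCStar
    fun a => evolveUniv_mem t a.2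

/-- The representation `π` of `C*(M₂(ℤ)⁺)` in `ℋ = ℓ²(M₂(ℤ)⁺)`. On generators,
`π(μ(g, L)) ε_m = ε_{gm}` if the columns of `m` are in `L`, and `π(μ(g, L)) ε_m = 0` otherwise. -/
def piRep : semigroupCStar →⋆ₐ[ℂ] (HS →L[ℂ] HS) := regUniv.comp semigroupCStar.subtype


theorem exists_lattice_eq (L : AddSubgroup (Fin 2 → ℤ)) (hL : L.FiniteIndex) :
    ∃ m : M2Z, m.lattice = L := by
  let N : Submodule ℤ (Fin 2 → ℤ) := AddSubgroup.toIntSubmodule L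
  have hmem : ∀ v, v ∈ N ↔ v ∈ L := fun v => Iff.rfl
  have hfin : Finite ((Fin 2 → ℤ) ⧸ N) := AddSubgroup.finite_quotient_of_finiteIndex (H := L)
  have hrank : Module.finrank ℤ N = 2 := by
    rw [(Submodule.finiteQuotient_iff N).1 hfin]; simp
  let b : Module.Basis (Fin 2) ℤ N := Module.finBasisOfFinrankEq ℤ N hrank
  have hdet := Submodule.natAbs_det_basis_change (Pi.basisFun ℤ (Fin 2)) N b
  have hrange : ∀ B : Matrix (Fin 2) (Fin 2) ℤ, (∃ ε : ℤ, ε * ε = 1 ∧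
      ∀ i, B i 0 = ε * (b 0 : Fin 2 → ℤ) i ∧ B i 1 = (b 1 : Fin 2 → ℤ) i) →
      B.mulVecLin.toAddMonoidHom.range = L := by
    rintro B ⟨ε, hε, hB⟩
    ext v
    constructor
    · rintro ⟨w, rfl⟩
      have : B.mulVec w = (ε * w 0) • (b 0 : Fin 2 → ℤ) + w 1 • (b 1 : Fin 2 → ℤ) := by
        ext i
        simp [Matrix.mulVec, dotProduct, Fin.sum_univ_two, hB]
        ring
      change B.mulVec w ∈ L
      rw [this]
      exact add_mem (L.zsmul_mem (b 0).2 _) (L.zsmul_mem (b 1).2 _)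
    · intro hv
      have h1 := b.sum_repr ⟨v, hv⟩
      refine ⟨![ε * b.repr ⟨v, hv⟩ 0, b.repr ⟨v, hv⟩ 1], ?_⟩
      change B.mulVec _ = v
      have h2 := congrArg (fun x : N => (x : Fin 2 → ℤ)) h1
      simp only [Fin.sum_univ_two] at h2
      ext i
      have h3 := congrFun h2 i
      simp only [Submodule.coe_add, Submodule.coe_smul, Pi.add_apply, Pi.smul_apply,
        smul_eq_mul] at h3
      simp only [Matrix.mulVec, dotProduct, Fin.sum_univ_two, hB, Matrix.cons_val_zero,
        Matrix.cons_val_one]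
      rw [← h3]
      linear_combination (b.repr ⟨v, hv⟩ 0 * (b 0 : Fin 2 → ℤ) i) * hε
  have hd : (Matrix.of fun i j => (b j : Fin 2 → ℤ) i).det ≠ 0 := by
    intro h0
    have h1 : (Pi.basisFun ℤ (Fin 2)).det (fun j => (b j : Fin 2 → ℤ)) = 0 := by
      rw [Module.Basis.det_apply]
      convert h0 using 2
      ext i j
      simp [Module.Basis.toMatrix_apply]
    have h2 : (Pi.basisFun ℤ (Fin 2)).det ((↑) ∘ b) = 0 := h1
    rw [h2] at hdet
    exact Nat.card_pos.ne' hdet.symm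
  rcases lt_or_gt_of_ne hd with h | h
  · refine ⟨⟨Matrix.of fun i j => (![-1, 1] j : ℤ) * (b j : Fin 2 → ℤ) i, ?_⟩,
      hrange _ ⟨-1, by norm_num, fun i => by simp [M2Z.mat]⟩⟩
    rw [Matrix.det_fin_two] at h ⊢
    simp at h ⊢
    linarith
  · exact ⟨⟨_, h⟩, hrange _ ⟨1, by norm_num, fun i => by simp [M2Z.mat]⟩⟩

theorem act_one_mem_latticeSet (m : M2Z) (L : AddSubgroup (Fin 2 → ℤ)) (hL : L.FiniteIndex) :
    act m.toGQ 1 ∈ latticeSet L ↔ ∀ j, (fun i => m.mat i j) ∈ L := by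
  obtain ⟨n, rfl⟩ := exists_lattice_eq L hL
  rw [latticeSet_lattice, Set.mem_preimage, ← act_mul, act_one_mem]
  constructor
  · rintro ⟨k, hk⟩ j
    have h1 : n.toGQ * k.toGQ = m.toGQ := by rw [hk]; group
    have h2 : n.mat * k.mat = m.mat := by
      have h3 := congrArg GQ.mat h1
      have h4 : GQ.mat (n.toGQ * k.toGQ) = GQ.mat n.toGQ * GQ.mat k.toGQ := rfl
      rw [h4, M2Z.mat_toGQ, M2Z.mat_toGQ, M2Z.mat_toGQ] at h3
      refine Matrix.map_injective (f := (Int.cast : ℤ → ℚ)) Int.cast_injective ?_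
      refine Eq.trans ?_ h3
      exact Matrix.map_mul (f := Int.castRingHom ℚ)
    refine ⟨fun i => k.mat i j, ?_⟩
    change n.mat.mulVec (fun i => k.mat i j) = _
    rw [← h2]
    rfl
  · intro h
    have hle : m.lattice ≤ n.lattice := by
      rintro _ ⟨w, rfl⟩
      change m.mat.mulVec w ∈ _
      have : m.mat.mulVec w = ∑ j, w j • fun i => m.mat i j := by
        ext i
        simp [Matrix.mulVec, dotProduct, mul_comm]
      rw [this]
      exact sum_mem fun j _ => n.lattice.zsmul_mem (h j) _
    obtain ⟨τ, hτ, h2⟩ := act_mem_of_lattice_le hle one_mem_MR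
    rw [← act_one_mem, act_mul, h2, ← act_mul, inv_mul_cancel, act_one]
    exact hτ

/-- The element `μ(g, L)` of `C*(M₂(ℤ)⁺)`. -/
def muElem (g : GQ) (L : AddSubgroup (Fin 2 → ℤ)) (h : IsAdmissible g L) : semigroupCStar :=
  ⟨univRep (mu g L), subset_closure (StarAlgebra.subset_adjoin ℂ generators ⟨g, L, h, rfl⟩)⟩

theorem piRep_muElem_apply (g : GQ) (L : AddSubgroup (Fin 2 → ℤ)) (h : IsAdmissible g L)
    (m n : M2Z) : piRep (muElem g L h) (basisVec m) n =
      if n.toGQ * m.toGQ⁻¹ = g then latticeProj L (act m.toGQ 1) else 0 := by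
  classical
  change regOp (mu g L) (basisVec m) n = _
  rw [regOp_basisVec, coef]
  have hd : act m.toGQ 1 ∈ dom (n.toGQ * m.toGQ⁻¹) :=
    ⟨(act_one_mem _).2 ⟨m, rfl⟩, by
      rw [Set.mem_preimage, ← act_mul, inv_mul_cancel_right]
      exact (act_one_mem _).2 ⟨n, rfl⟩⟩
  refine (ev_mk hd).trans ?_
  by_cases hg : n.toGQ * m.toGQ⁻¹ = g
  · rw [if_pos hg]
  · rw [if_neg hg]

/-- `π(μ(g, L)) ε_m = ε_{gm}` if the columns of `m` are in `L`. -/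
theorem piRep_muElem (g : GQ) (L : AddSubgroup (Fin 2 → ℤ)) (h : IsAdmissible g L) (m n : M2Z)
    (hm : ∀ j, (fun i => m.mat i j) ∈ L) (hn : n.toGQ = g * m.toGQ) :
    piRep (muElem g L h) (basisVec m) = basisVec n := by
  classical
  ext k
  rw [piRep_muElem_apply, basisVec_apply, latticeProj,
    Set.indicator_of_mem ((act_one_mem_latticeSet m L h.1).2 hm)]
  have : k.toGQ * m.toGQ⁻¹ = g ↔ k = n := by
    rw [mul_inv_eq_iff_eq_mul, ← hn, M2Z.toGQ_injective.eq_iff]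
  by_cases hk : k = n
  · rw [if_pos hk, if_pos (this.2 hk)]
  · rw [if_neg hk, if_neg (fun h => hk (this.1 h))]

/-- `π(μ(g, L)) ε_m = 0` if the columns of `m` are not all in `L`. -/
theorem piRep_muElem_eq_zero (g : GQ) (L : AddSubgroup (Fin 2 → ℤ)) (h : IsAdmissible g L)
    (m : M2Z) (hm : ¬ ∀ j, (fun i => m.mat i j) ∈ L) :
    piRep (muElem g L h) (basisVec m) = 0 := by
  ext k
  rw [piRep_muElem_apply, latticeProj,
    Set.indicator_of_notMem (fun h' => hm ((act_one_mem_latticeSet m L h.1).1 h')), ite_self]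
  rfl

/-! ### The Hamiltonian and the `Γ`-trace -/

open Classical in
/-- The diagonal operator `ε_m ↦ w(m) ε_m`, for a bounded function `w` (`0` if `w` is not
bounded). -/
def diagOp (w : M2Z → ℂ) : HS →L[ℂ] HS :=
  if h : ∃ C, 0 ≤ C ∧ ∀ m, ‖w m‖ ≤ C then
    wop id id Function.injective_id Function.injective_id w h.choose h.choose_spec.1
      h.choose_spec.2
  else 0

/-- The eigenvalues of the Hamiltonian: `H ε_m = log Det(m) ε_m`. -/
def energy (m : M2Z) : ℝ := Real.log m.det

/-- The operator `e^{-βH}`, which is bounded for `β ≥ 0`. -/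
def expNegH (β : ℝ) : HS →L[ℂ] HS := diagOp fun m => Real.exp (-β * energy m)

/-- The action of `Γ = SL₂(ℤ)` on `M₂(ℤ)⁺` by `γ • m = m γ⁻¹`. -/
instance : MulAction SL(2, ℤ) M2Z where
  smul γ m := ⟨m.mat * (γ⁻¹ : SL(2, ℤ)).1, by
    rw [Matrix.det_mul, (γ⁻¹ : SL(2, ℤ)).2, mul_one]; exact m.2⟩
  one_smul m := M2Z.mat_injective (by
    change m.mat * ((1 : SL(2, ℤ))⁻¹ : SL(2, ℤ)).1 = m.mat
    simp)
  mul_smul γ γ' m := M2Z.mat_injective (by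
    change m.mat * ((γ * γ')⁻¹ : SL(2, ℤ)).1 =
      m.mat * (γ'⁻¹ : SL(2, ℤ)).1 * (γ⁻¹ : SL(2, ℤ)).1
    rw [mul_inv_rev, Matrix.mul_assoc]
    rfl)

/-- The unitary operator `ρ(γ) ε_m = ε_{m γ⁻¹}`. -/
def rightOp (γ : SL(2, ℤ)) : HS →L[ℂ] HS :=
  wop id (fun m => γ⁻¹ • m) Function.injective_id (MulAction.injective γ⁻¹) (fun _ => 1) 1
    zero_le_one (fun _ => by simp)

/-- The set of orbits `M₂(ℤ)⁺/Γ`. -/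
abbrev Orbits : Type := MulAction.orbitRel.Quotient SL(2, ℤ) M2Z

/-- The commutant of `ρ(Γ)`. -/
def commutant : Set (HS →L[ℂ] HS) := Set.centralizer (Set.range rightOp)

/-- The diagonal matrix coefficient `⟨ε_m, T ε_m⟩` at a representative `m` of an orbit; for `T` in
the commutant of `ρ(Γ)` it does not depend on the choice of the representative. -/
def orbitCoef (T : HS →L[ℂ] HS) (q : Orbits) : ℂ :=
  inner ℂ (basisVec q.out) (T (basisVec q.out))

/-- The trace `Trace_Γ` of the commutant of `ρ(Γ)`. The group `Γ` acts freely on `M₂(ℤ)⁺`, so the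
choice of a set `D` of representatives of the orbits identifies `ℋ` with `ℓ²(Γ) ⊗ ℓ²(D)`, and
`Trace_Γ` with the tensor product of the canonical trace of the group von Neumann algebra of `Γ`
and the usual trace: `Trace_Γ(T) = ∑_{m ∈ D} ⟨ε_m, T ε_m⟩`. -/
def gammaTrace (T : HS →L[ℂ] HS) : ℂ := ∑' q, orbitCoef T q

/-- The sum defining `Trace_Γ(T)` converges absolutely. -/
def IsGammaTraceable (T : HS →L[ℂ] HS) : Prop := T ∈ commutant ∧ Summable (orbitCoef T)

open Classical in
/-- The projection onto the span of the `ε_m` with `Det(m) = N`. -/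
def detProj (N : ℕ) : HS →L[ℂ] HS := diagOp fun m => if m.mat.det = N then 1 else 0

/-- The normalization factor `Z(β) = Trace_Γ(e^{-βH})`. -/
def Z (β : ℝ) : ℂ := gammaTrace (expNegH β)

/-- The functional `φ_β(x) = Trace_Γ(π(x) e^{-βH})`. -/
def phi (β : ℝ) (x : semigroupCStar) : ℂ := gammaTrace (piRep x * expNegH β)

/-! ### KMS states -/

/-- A state of a unital `C*`-algebra. -/
structure IsState {B : Type*} [Ring B] [StarRing B] [Algebra ℂ B] (φ : B → ℂ) : Prop where
  linear : IsLinearMap ℂ φ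
  map_one : φ 1 = 1
  nonneg : ∀ a, 0 ≤ φ (star a * a)

/-- A `KMS_β` state for the time evolution `σ`: for all `a, b` there is a bounded continuous
function `F` on the strip `0 ≤ Im z ≤ β`, holomorphic inside, with `F(t) = φ(a σ_t(b))` and
`F(t + iβ) = φ(σ_t(b) a)`. -/
structure IsKMSState {B : Type*} [Ring B] [StarRing B] [Algebra ℂ B] (σ : ℝ → B → B) (β : ℝ)
    (φ : B → ℂ) : Prop extends IsState φ where
  kms : ∀ a b : B, ∃ F : ℂ → ℂ,
    ContinuousOn F {z | 0 ≤ z.im ∧ z.im ≤ β} ∧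
    DifferentiableOn ℂ F {z | 0 < z.im ∧ z.im < β} ∧
    (∃ C : ℝ, ∀ z : ℂ, 0 ≤ z.im → z.im ≤ β → ‖F z‖ ≤ C) ∧
    ∀ t : ℝ, F t = φ (a * σ t b) ∧ F (t + Complex.I * β) = φ (σ t b * a)

end DetSystem

end

noncomputable section

namespace DetSystem

open CcG2

/-! ### Orbits and Hermite normal forms -/

/-! The group `Γ` acts freely on `M₂(ℤ)⁺` from the right. By column reduction every orbit contains
exactly one matrix with rows `(a, b)` and `(0, d)`, where `0 ≤ b < a` (`hermite_bijective`). For a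
fixed determinant `N = ad` there are `a` choices of `b`, hence `σ₁(N)` orbits. Weighting each orbit
by `(ad)^{-β}` gives the double series of `a^{-(β-1)} d^{-β}`, which converges for `β > 2` and
factors into the two zeta values (`sum_orbits_rpow`, `partition_eq`).

The generators act by left multiplication and test whether the columns of `m` lie in `L`. Both
operations are compatible with right multiplication by `Γ`, so the image of `π` lies in the
commutant (`piRep_mem_commutant`). Diagonal coefficients are bounded by the operator norm, so
finiteness of `Z(β)` gives absolute convergence of every trace needed. Positivity holds because the
diagonal coefficients of `π(a)* π(a)` are squared norms.

For the KMS condition the candidate is `F(z) = Trace_Γ(A e^{izH} B e^{-izH} e^{-βH})`, expanded as a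
sum over pairs `(x, y)` modulo the diagonal action of `Γ`, with `x` in the chosen set of
representatives. On the lower edge of the strip the weight `e^{-βH}` sits at `x`, on the upper edge
at `y`. Since the terms are invariant under the diagonal action, representatives of pairs may be
normalized at `y` instead (`pairSwap_apply`). This exchange is the trace property and gives the
upper boundary value (`kmsFun_top`). A single summable bound (`kmsTerm_norm_le`,
`summable_kmsBound`) controls the series on the whole closed strip. -/

theorem smul_mat (γ : SL(2, ℤ)) (m : M2Z) : (γ • m).mat = m.mat * (γ⁻¹ : SL(2, ℤ)).1 := rfl

theorem det_mat_smul (γ : SL(2, ℤ)) (m : M2Z) : (γ • m).mat.det = m.mat.det := by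
  rw [smul_mat, Matrix.det_mul, (γ⁻¹ : SL(2, ℤ)).2, mul_one]

theorem det_smul (γ : SL(2, ℤ)) (m : M2Z) : (γ • m).det = m.det := by
  rw [M2Z.det, M2Z.det, det_mat_smul]

/-- The indices `(a, d, b)` with `0 ≤ b < a` of the matrices in Hermite normal form. -/
abbrev HermiteIndex : Type := Σ p : ℕ+ × ℕ+, Fin p.1

/-- The matrix with rows `(a, b)` and `(0, d)`. -/
def hermite (x : HermiteIndex) : M2Z :=
  ⟨!![((x.1.1 : ℕ) : ℤ), ((x.2 : ℕ) : ℤ); 0, ((x.1.2 : ℕ) : ℤ)], by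
    rw [Matrix.det_fin_two_of]
    simp⟩

theorem hermite_mat (x : HermiteIndex) : (hermite x).mat =
    !![((x.1.1 : ℕ) : ℤ), ((x.2 : ℕ) : ℤ); 0, ((x.1.2 : ℕ) : ℤ)] := rfl

theorem det_hermite (x : HermiteIndex) :
    (hermite x).mat.det = ((x.1.1 * x.1.2 : ℕ) : ℤ) := by
  rw [hermite_mat, Matrix.det_fin_two_of]
  push_cast
  ring

/-- The vanishing lower left entry forces `γ` to be upper triangular. Its diagonal entries are
units, and positivity of `d` and `d'` makes them `1`. What remains is `b' = a γ₀₁ + b`, so `b` and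
`b'` are residues in `[0, a)` congruent modulo `a`. -/
theorem hermite_injective_mod (x y : HermiteIndex) (γ : SL(2, ℤ))
    (h : (hermite x).mat * γ.1 = (hermite y).mat) : x = y := by
  obtain ⟨⟨a, d⟩, b⟩ := x
  obtain ⟨⟨a', d'⟩, b'⟩ := y
  have hdet : γ.1 0 0 * γ.1 1 1 - γ.1 0 1 * γ.1 1 0 = 1 := by
    rw [← Matrix.det_fin_two]; exact γ.2
  simp only [hermite_mat] at h
  have e00 := congrFun (congrFun h 0) 0
  have e01 := congrFun (congrFun h 0) 1
  have e10 := congrFun (congrFun h 1) 0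
  have e11 := congrFun (congrFun h 1) 1
  simp [Matrix.mul_apply, Fin.sum_univ_two] at e00 e01 e10 e11
  have ha := a.pos
  have ha' := a'.pos
  have hd := d.pos
  have hd' := d'.pos
  rw [e10] at e00 hdet
  simp only [mul_zero, add_zero, sub_zero] at e00 hdet
  have hs : 0 < γ.1 1 1 := by
    have : (0 : ℤ) < (d : ℕ) * γ.1 1 1 := by rw [e11]; exact_mod_cast hd'
    exact pos_of_mul_pos_right this (by positivity)
  have hs1 : γ.1 1 1 = 1 := by
    rcases Int.eq_one_or_neg_one_of_mul_eq_one' hdet with h | h <;> omega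
  have hp1 : γ.1 0 0 = 1 := by rw [hs1, mul_one] at hdet; exact hdet
  rw [hs1, mul_one] at e11 e01
  rw [hp1, mul_one] at e00
  have h1 : a = a' := PNat.eq (by exact_mod_cast e00)
  have h2 : d = d' := PNat.eq (by exact_mod_cast e11)
  subst h1 h2
  have hb := b.2
  have hb' := b'.2
  have hb2 : (b : ℕ) = (b' : ℕ) := by
    have h3 : ((b : ℕ) : ℤ) % ((a : ℕ) : ℤ) = ((b' : ℕ) : ℤ) % ((a : ℕ) : ℤ) := by
      rw [← e01, Int.mul_add_emod_self_left]
    rw [Int.emod_eq_of_lt (by positivity) (by exact_mod_cast hb),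
      Int.emod_eq_of_lt (by positivity) (by exact_mod_cast hb')] at h3
    exact_mod_cast h3
  rw [Fin.ext hb2]

/-- Bézout for the bottom row `(c, d)` with gcd `g` provides a unimodular column operation that
turns it into `(0, g)`. The upper left entry is then `A = det m / g > 0`, and subtracting a multiple
of the first column from the second reduces the upper right entry modulo `A`. -/
theorem exists_hermite (m : M2Z) : ∃ (γ : SL(2, ℤ)) (x : HermiteIndex),
    m.mat * γ.1 = (hermite x).mat := by
  have hm : 0 < m.mat.det := m.2
  rw [Matrix.det_fin_two] at hm
  obtain ⟨a, ha⟩ : ∃ a, a = m.mat 0 0 := ⟨_, rfl⟩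
  obtain ⟨b, hb⟩ : ∃ b, b = m.mat 0 1 := ⟨_, rfl⟩
  obtain ⟨c, hc⟩ : ∃ c, c = m.mat 1 0 := ⟨_, rfl⟩
  obtain ⟨d, hd⟩ : ∃ d, d = m.mat 1 1 := ⟨_, rfl⟩
  have hmat : m.mat = !![a, b; c, d] := by
    rw [ha, hb, hc, hd]; exact Matrix.eta_fin_two _
  rw [← ha, ← hb, ← hc, ← hd] at hm
  have hg : 0 < Int.gcd c d := by
    rw [Int.gcd_pos_iff]
    by_contra h
    push Not at h
    rw [h.1, h.2] at hm
    simp at hm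
  obtain ⟨c', hc'⟩ : ((Int.gcd c d : ℕ) : ℤ) ∣ c := Int.gcd_dvd_left ..
  obtain ⟨d', hd'⟩ : ((Int.gcd c d : ℕ) : ℤ) ∣ d := Int.gcd_dvd_right ..
  have hbez := Int.gcd_eq_gcd_ab c d
  set g := Int.gcd c d
  set u := Int.gcdA c d
  set v := Int.gcdB c d
  have hg' : (0 : ℤ) < g := by exact_mod_cast hg
  have huv : d' * v + c' * u = 1 := by
    have h : (g : ℤ) * (d' * v + c' * u) = g * 1 := by
      rw [mul_one, mul_add, ← mul_assoc, ← mul_assoc, ← hd', ← hc', add_comm]; exact hbez.symm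
    exact mul_left_cancel₀ hg'.ne' h
  have hA : 0 < a * d' - b * c' := by
    have h : 0 < (g : ℤ) * (a * d' - b * c') := by
      have : (g : ℤ) * (a * d' - b * c') = a * (g * d') - b * (g * c') := by ring
      rw [this, ← hd', ← hc']; exact hm
    exact pos_of_mul_pos_right h hg'.le
  obtain ⟨A, hAA⟩ := Int.eq_ofNat_of_zero_le hA.le
  have hApos : 0 < A := by omega
  -- Before reduction the upper right entry is `a u + b v`; `k` is its quotient by `A`, and `r`
  -- below is the remainder.
  obtain ⟨k, hk⟩ : ∃ k, k = (a * u + b * v) / A := ⟨_, rfl⟩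
  have hr0 := Int.emod_nonneg (a * u + b * v) (show (A : ℤ) ≠ 0 by omega)
  have hr1 := Int.emod_lt_of_pos (a * u + b * v) (show (0 : ℤ) < A by omega)
  have hr := Int.emod_add_mul_ediv (a * u + b * v) A
  rw [← hk] at hr
  obtain ⟨r, hrr⟩ := Int.eq_ofNat_of_zero_le hr0
  rw [hrr] at hr hr1
  -- The first column annihilates the bottom row; the second is the Bézout vector `(u, v)` minus `k`
  -- times the first.
  refine ⟨⟨!![d', u - k * d'; -c', v + k * c'], ?_⟩,
    ⟨(⟨A, hApos⟩, ⟨g, hg⟩), ⟨r, by exact_mod_cast hr1⟩⟩, ?_⟩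
  · rw [Matrix.det_fin_two_of]; linear_combination huv
  · rw [hmat, hermite_mat]
    simp only [Matrix.mul_fin_two, PNat.mk_coe]
    rw [show a * d' + b * -c' = (A : ℤ) by linarith,
      show a * (u - k * d') + b * (v + k * c') = (r : ℤ) by
        linear_combination (-k) * hAA - hr,
      show c * d' + d * -c' = 0 by rw [hc', hd']; ring,
      show c * (u - k * d') + d * (v + k * c') = (g : ℤ) by
        linear_combination (-k * d') * hc' + (k * c') * hd' - hbez]

theorem orbit_eq_iff (m n : M2Z) :
    (Quotient.mk'' m : Orbits) = Quotient.mk'' n ↔ ∃ γ : SL(2, ℤ), m = γ • n := by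
  rw [Quotient.eq'', MulAction.orbitRel_apply]
  exact ⟨fun ⟨γ, h⟩ => ⟨γ, h.symm⟩, fun ⟨γ, h⟩ => ⟨γ, h.symm⟩⟩

/-- Each orbit contains exactly one matrix in Hermite normal form. -/
theorem hermite_bijective :
    Function.Bijective fun x : HermiteIndex => (Quotient.mk'' (hermite x) : Orbits) := by
  constructor
  · intro x y h
    obtain ⟨γ, hγ⟩ := (orbit_eq_iff _ _).1 h.symm
    refine hermite_injective_mod x y γ⁻¹ ?_
    rw [hγ, smul_mat]
  · intro q
    induction q using Quotient.inductionOn' with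
    | h m =>
      obtain ⟨γ, x, h⟩ := exists_hermite m
      refine ⟨x, (orbit_eq_iff _ _).2 ⟨γ⁻¹, M2Z.mat_injective ?_⟩⟩
      rw [smul_mat, inv_inv, h]

/-- The parametrization of the orbits by Hermite normal forms. -/
def orbitEquiv : HermiteIndex ≃ Orbits := Equiv.ofBijective _ hermite_bijective

theorem exists_smul_out (m : M2Z) : ∃ γ : SL(2, ℤ), γ • (Quotient.mk'' m : Orbits).out = m := by
  have h : (Quotient.mk'' m : Orbits) = Quotient.mk'' (Quotient.mk'' m : Orbits).out :=
    (Quotient.out_eq' _).symm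
  obtain ⟨γ, hγ⟩ := (orbit_eq_iff _ _).1 h
  exact ⟨γ, hγ.symm⟩

/-- The representative chosen by `Quotient.out` need not be the Hermite matrix, but the determinant
is constant on orbits. -/
theorem det_out (x : HermiteIndex) :
    (orbitEquiv x).out.mat.det = ((x.1.1 * x.1.2 : ℕ) : ℤ) := by
  obtain ⟨γ, hγ⟩ := exists_smul_out (hermite x)
  rw [← det_hermite]
  conv_rhs => rw [← hγ, det_mat_smul]
  rfl

theorem det_out_real (x : HermiteIndex) :
    (orbitEquiv x).out.det = ((x.1.1 : ℕ) : ℝ) * ((x.1.2 : ℕ) : ℝ) := by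
  rw [M2Z.det, det_out]
  push_cast
  rfl

/-- `Γ` acts freely on `M₂(ℤ)⁺`. -/
theorem smul_left_injective (m : M2Z) : Function.Injective fun γ : SL(2, ℤ) => γ • m := by
  intro γ γ' h
  have h1 : m.mat * (γ⁻¹ : SL(2, ℤ)).1 = m.mat * (γ'⁻¹ : SL(2, ℤ)).1 := congrArg M2Z.mat h
  have h2 : m.mat.det ≠ 0 := (show 0 < m.mat.det from m.2).ne'
  -- Multiplying by the adjugate replaces `m` by the scalar `det m`, which cancels over `ℤ`.
  have h3 := congrArg (m.mat.adjugate * ·) h1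
  simp only [← Matrix.mul_assoc, Matrix.adjugate_mul, smul_mul_assoc, one_mul] at h3
  exact inv_injective (Subtype.ext (smul_right_injective _ h2 h3))

/-! ### Counting orbits: `σ₁` and the zeta product -/

theorem sum_orbits_indicator (N : ℕ) (hN : 1 ≤ N) :
    HasSum (fun x : HermiteIndex => if (x.1.1 * x.1.2 : ℕ) = N then (1 : ℝ) else 0)
      (ArithmeticFunction.sigma 1 N : ℕ) := by
  have h1 : HasSum (fun p : ℕ × ℕ => if p.1 * p.2 = N then (p.1 : ℝ) else 0)
      (ArithmeticFunction.sigma 1 N : ℕ) := by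
    have h : ((ArithmeticFunction.sigma 1 N : ℕ) : ℝ) =
        ∑ p ∈ N.divisorsAntidiagonal, if p.1 * p.2 = N then (p.1 : ℝ) else 0 := by
      rw [ArithmeticFunction.sigma_one_apply, Nat.cast_sum,
        ← Nat.sum_divisorsAntidiagonal (f := fun d _ => (d : ℝ))]
      exact Finset.sum_congr rfl fun p hp => (if_pos (Nat.mem_divisorsAntidiagonal.1 hp).1).symm
    rw [h]
    refine hasSum_sum_of_ne_finset_zero fun p hp => if_neg fun h' => hp ?_
    exact Nat.mem_divisorsAntidiagonal.2 ⟨h', by omega⟩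
  have h2 : HasSum (fun p : ℕ+ × ℕ+ => if (p.1 * p.2 : ℕ) = N then ((p.1 : ℕ) : ℝ) else 0)
      (ArithmeticFunction.sigma 1 N : ℕ) := by
    -- Since `N ≥ 1`, pairs with a zero entry contribute nothing, so the sum may be restricted to
    -- positive pairs.
    have hinj : Function.Injective fun p : ℕ+ × ℕ+ => ((p.1 : ℕ), (p.2 : ℕ)) := by
      rintro ⟨a, b⟩ ⟨c, d⟩ h
      simpa using h
    refine (hinj.hasSum_iff ?_).2 h1
    rintro ⟨a, d⟩ h
    refine if_neg fun h' => h ?_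
    have ha : 0 < a := Nat.pos_of_ne_zero fun h0 => by simp [h0] at h'; omega
    have hd : 0 < d := Nat.pos_of_ne_zero fun h0 => by simp [h0] at h'; omega
    exact ⟨(⟨a, ha⟩, ⟨d, hd⟩), rfl⟩
  -- The `a` choices of `b` over each `(a, d)` turn the indicator of `ad = N` into the weight `a`.
  have h3 : ∀ p : ℕ+ × ℕ+, HasSum (fun _ : Fin p.1 => if (p.1 * p.2 : ℕ) = N then (1 : ℝ) else 0)
      (if (p.1 * p.2 : ℕ) = N then ((p.1 : ℕ) : ℝ) else 0) := by
    intro p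
    have h := hasSum_fintype fun _ : Fin p.1 => if (p.1 * p.2 : ℕ) = N then (1 : ℝ) else 0
    simpa using h
  refine HasSum.sigma_of_hasSum h2 h3 ?_
  refine (summable_sigma_of_nonneg fun x => by split_ifs <;> simp).2 ⟨fun p => (h3 p).summable, ?_⟩
  exact h2.summable.congr fun p => (h3 p).tsum_eq.symm

theorem hasSum_pnat_rpow (s : ℝ) (hs : 1 < s) :
    HasSum (fun n : ℕ+ => ((n : ℕ) : ℝ) ^ (-s)) (∑' n : ℕ, (n : ℝ) ^ (-s)) := by
  have h1 : Summable fun n : ℕ => (n : ℝ) ^ (-s) := Real.summable_nat_rpow.2 (by linarith)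
  refine (PNat.coe_injective.hasSum_iff (f := fun n : ℕ => (n : ℝ) ^ (-s)) ?_).2 h1.hasSum
  intro n hn
  have : n = 0 := by
    by_contra h
    exact hn ⟨⟨n, Nat.pos_of_ne_zero h⟩, rfl⟩
  -- With the convention `0 ^ (-s) = 0` for `s ≠ 0`, the term at `n = 0` is harmless.
  rw [this, Nat.cast_zero, Real.zero_rpow (by linarith)]

theorem zeta_eq_ofReal (s : ℝ) (hs : 1 < s) :
    riemannZeta (s : ℂ) = ((∑' n : ℕ, (n : ℝ) ^ (-s) : ℝ) : ℂ) := by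
  rw [zeta_eq_tsum_one_div_nat_cpow (by simpa using hs), Complex.ofReal_tsum]
  refine tsum_congr fun n => ?_
  rw [Complex.ofReal_cpow (by positivity), Complex.ofReal_neg, Complex.cpow_neg, one_div,
    Complex.ofReal_natCast]

/-- The fibre over `(a, d)` has `a` elements, and `a · (ad)^{-β} = a^{-(β-1)} d^{-β}`. The double
series is therefore a product; its first factor needs `β - 1 > 1`. -/
theorem sum_orbits_rpow (β : ℝ) (hβ : 2 < β) :
    HasSum (fun x : HermiteIndex => (((x.1.1 : ℕ) : ℝ) * ((x.1.2 : ℕ) : ℝ)) ^ (-β))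
      ((∑' n : ℕ, (n : ℝ) ^ (-(β - 1))) * ∑' n : ℕ, (n : ℝ) ^ (-β)) := by
  have ha := hasSum_pnat_rpow (β - 1) (by linarith)
  have hd := hasSum_pnat_rpow β (by linarith)
  have h2 := ha.mul hd
    (ha.summable.mul_of_nonneg hd.summable (fun _ => by positivity) (fun _ => by positivity))
  have h3 : ∀ p : ℕ+ × ℕ+, HasSum
      (fun _ : Fin p.1 => (((p.1 : ℕ) : ℝ) * ((p.2 : ℕ) : ℝ)) ^ (-β))
      (((p.1 : ℕ) : ℝ) ^ (-(β - 1)) * ((p.2 : ℕ) : ℝ) ^ (-β)) := by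
    intro p
    have h := hasSum_fintype fun _ : Fin p.1 => (((p.1 : ℕ) : ℝ) * ((p.2 : ℕ) : ℝ)) ^ (-β)
    have hp : (0 : ℝ) < (p.1 : ℕ) := by exact_mod_cast p.1.pos
    rw [neg_sub, sub_eq_add_neg, Real.rpow_add hp, Real.rpow_one, mul_assoc,
      ← Real.mul_rpow hp.le (by positivity)]
    simpa using h
  refine HasSum.sigma_of_hasSum h2 h3 ?_
  refine (summable_sigma_of_nonneg fun x => by positivity).2 ⟨fun p => (h3 p).summable, ?_⟩
  exact h2.summable.congr fun p => (h3 p).tsum_eq.symm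

/-! ### Matrix coefficients -/

section Ell2

variable {M : Type}

theorem norm_basisVec (m : M) : ‖basisVec m‖ = 1 := by
  classical
  rw [basisVec, lp.norm_single (by simp), norm_one]

theorem norm_coef_le (T : Ell2 M →L[ℂ] Ell2 M) (m n : M) : ‖T (basisVec m) n‖ ≤ ‖T‖ := by
  refine (lp.norm_apply_le_norm (by simp) _ n).trans ((T.le_opNorm _).trans ?_)
  rw [norm_basisVec, mul_one]

theorem hasSum_norm_sq (ξ : Ell2 M) : HasSum (fun n => ‖ξ n‖ ^ 2) (‖ξ‖ ^ 2) := by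
  have h := lp.hasSum_norm (p := 2) (by simp) ξ
  simpa using h

theorem mul_coef (A B : Ell2 M →L[ℂ] Ell2 M) (m n : M) :
    (A * B) (basisVec m) n = ∑' k, A (basisVec k) n * B (basisVec m) k := by
  rw [mul_apply_eq_comp]
  exact (op_apply A (B (basisVec m)) n).tsum_eq.symm

theorem star_mul_self_coef (A : Ell2 M →L[ℂ] Ell2 M) (m : M) :
    (star A * A) (basisVec m) m = ((‖A (basisVec m)‖ ^ 2 : ℝ) : ℂ) := by
  rw [← inner_basisVec m, mul_apply_eq_comp, ContinuousLinearMap.star_eq_adjoint,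
    ContinuousLinearMap.adjoint_inner_right, inner_self_eq_norm_sq_to_K]
  push_cast
  rfl

end Ell2

/-- An explicit bound excludes the default value `0` in `diagOp`. The constant chosen there enters
only the continuity proof, so any bound gives the same operator. -/
theorem diagOp_apply (w : M2Z → ℂ) (C : ℝ) (h0 : 0 ≤ C) (hC : ∀ m, ‖w m‖ ≤ C) (ξ : HS) (n : M2Z) :
    diagOp w ξ n = w n * ξ n := by
  rw [diagOp, dif_pos ⟨C, h0, hC⟩]
  exact congrArg (w n * ·) (Function.injective_id.extend_apply ξ 0 n)

theorem diagOp_basisVec (w : M2Z → ℂ) (C : ℝ) (h0 : 0 ≤ C) (hC : ∀ m, ‖w m‖ ≤ C) (m : M2Z) :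
    diagOp w (basisVec m) = w m • basisVec m := by
  ext n
  rw [diagOp_apply w C h0 hC]
  change _ = w m * basisVec m n
  rw [basisVec_apply]
  split_ifs with h
  · rw [h]
  · rw [mul_zero, mul_zero]

theorem rightOp_apply (γ : SL(2, ℤ)) (ξ : HS) (n : M2Z) : rightOp γ ξ n = ξ (γ⁻¹ • n) := by
  exact (one_mul _).trans (Function.injective_id.extend_apply ξ 0 (γ⁻¹ • n))

theorem rightOp_basisVec (γ : SL(2, ℤ)) (m : M2Z) : rightOp γ (basisVec m) = basisVec (γ • m) := by
  classical
  ext n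
  rw [rightOp_apply, basisVec_apply, basisVec_apply]
  exact if_congr inv_smul_eq_iff rfl rfl

theorem star_rightOp (γ : SL(2, ℤ)) : star (rightOp γ) = rightOp γ⁻¹ := by
  classical
  refine op_ext fun m n => ?_
  rw [star_op_apply, rightOp_basisVec, rightOp_basisVec, basisVec_apply, basisVec_apply]
  simp only [eq_inv_smul_iff, eq_comm]
  split_ifs <;> simp

/-- Each `ρ(γ)` permutes the basis, so commuting with `ρ(Γ)` means that the matrix of `T` is
constant on the diagonal `Γ`-orbits of pairs. In this form the commutant feeds into the sums over
orbits of pairs. -/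
theorem mem_commutant_iff (T : HS →L[ℂ] HS) : T ∈ commutant ↔
    ∀ (γ : SL(2, ℤ)) (m n : M2Z), T (basisVec (γ • m)) (γ • n) = T (basisVec m) n := by
  rw [commutant, Set.mem_centralizer_iff]
  constructor
  · intro h γ m n
    have h1 := h (rightOp γ) ⟨γ, rfl⟩
    have h2 := congrArg (fun S : HS →L[ℂ] HS => S (basisVec m) (γ • n)) h1
    simp only [mul_apply_eq_comp, rightOp_basisVec, rightOp_apply, inv_smul_smul] at h2
    exact h2.symm
  · rintro h _ ⟨γ, rfl⟩
    refine op_ext fun m n => ?_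
    rw [mul_apply_eq_comp, mul_apply_eq_comp, rightOp_basisVec, rightOp_apply,
      ← h γ m (γ⁻¹ • n), smul_inv_smul]

theorem orbitCoef_eq (T : HS →L[ℂ] HS) (q : Orbits) : orbitCoef T q = T (basisVec q.out) q.out :=
  inner_basisVec _ _

theorem diagOp_mem_commutant (w : M2Z → ℂ) (C : ℝ) (h0 : 0 ≤ C) (hC : ∀ m, ‖w m‖ ≤ C)
    (hw : ∀ (γ : SL(2, ℤ)) (m : M2Z), w (γ • m) = w m) : diagOp w ∈ commutant := by
  classical
  rw [mem_commutant_iff]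
  intro γ m n
  rw [diagOp_apply w C h0 hC, diagOp_apply w C h0 hC, hw, basisVec_apply, basisVec_apply]
  exact congrArg (w n * ·) (if_congr (smul_left_cancel_iff γ) rfl rfl)

theorem orbitCoef_diagOp (w : M2Z → ℂ) (C : ℝ) (h0 : 0 ≤ C) (hC : ∀ m, ‖w m‖ ≤ C) (q : Orbits) :
    orbitCoef (diagOp w) q = w q.out := by
  rw [orbitCoef_eq, diagOp_apply w C h0 hC, basisVec_apply, if_pos rfl, mul_one]

/-! ### The traces of `e^{-βH}` and of the projections of fixed determinant -/

theorem energy_nonneg (m : M2Z) : 0 ≤ energy m := Real.log_nonneg m.one_le_det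

theorem energy_smul (γ : SL(2, ℤ)) (m : M2Z) : energy (γ • m) = energy m := by
  rw [energy, energy, det_smul]

theorem norm_exp_energy_le (β : ℝ) (hβ : 0 ≤ β) (m : M2Z) :
    ‖((Real.exp (-β * energy m) : ℝ) : ℂ)‖ ≤ 1 := by
  rw [Complex.norm_real, Real.norm_eq_abs, abs_of_pos (Real.exp_pos _), Real.exp_le_one_iff,
    neg_mul, neg_nonpos]
  exact mul_nonneg hβ (energy_nonneg m)

theorem expNegH_basisVec (β : ℝ) (hβ : 0 ≤ β) (m : M2Z) :
    expNegH β (basisVec m) = ((Real.exp (-β * energy m) : ℝ) : ℂ) • basisVec m :=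
  diagOp_basisVec _ 1 zero_le_one (norm_exp_energy_le β hβ) m

theorem expNegH_mem_commutant (β : ℝ) (hβ : 0 ≤ β) : expNegH β ∈ commutant :=
  diagOp_mem_commutant _ 1 zero_le_one (norm_exp_energy_le β hβ) fun γ m => by rw [energy_smul]

theorem mul_expNegH_coef (β : ℝ) (hβ : 0 ≤ β) (T : HS →L[ℂ] HS) (m n : M2Z) :
    (T * expNegH β) (basisVec m) n = ((Real.exp (-β * energy m) : ℝ) : ℂ) * T (basisVec m) n := by
  rw [mul_apply_eq_comp, expNegH_basisVec β hβ, map_smul]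
  rfl

theorem orbitCoef_mul_expNegH (β : ℝ) (hβ : 0 ≤ β) (T : HS →L[ℂ] HS) (q : Orbits) :
    orbitCoef (T * expNegH β) q =
      ((Real.exp (-β * energy q.out) : ℝ) : ℂ) * T (basisVec q.out) q.out := by
  rw [orbitCoef_eq, mul_expNegH_coef β hβ]

/-- The partition function as a real number. -/
def partition (β : ℝ) : ℝ := (∑' n : ℕ, (n : ℝ) ^ (-(β - 1))) * ∑' n : ℕ, (n : ℝ) ^ (-β)

theorem hasSum_exp_energy (β : ℝ) (hβ : 2 < β) :
    HasSum (fun q : Orbits => Real.exp (-β * energy q.out)) (partition β) := by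
  refine orbitEquiv.hasSum_iff.1 ((sum_orbits_rpow β hβ).congr_fun fun x => ?_)
  rw [Function.comp_apply, energy, ← det_out_real,
    Real.rpow_def_of_pos (zero_lt_one.trans_le (M2Z.one_le_det _)), mul_comm]

theorem partition_pos (β : ℝ) (hβ : 2 < β) : 0 < partition β :=
  lt_of_lt_of_le (Real.exp_pos _) (le_hasSum (hasSum_exp_energy β hβ)
    (Quotient.mk'' (Classical.arbitrary M2Z)) fun _ _ => (Real.exp_pos _).le)

theorem isGammaTraceable_expNegH (β : ℝ) (hβ : 2 < β) :
    IsGammaTraceable (expNegH β) ∧ Z β = partition β := by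
  have h : HasSum (orbitCoef (expNegH β)) (partition β : ℂ) := by
    have h1 := Complex.hasSum_ofReal.2 (hasSum_exp_energy β hβ)
    refine h1.congr_fun fun q => ?_
    exact orbitCoef_diagOp _ 1 zero_le_one (norm_exp_energy_le β (by linarith)) q
  exact ⟨⟨expNegH_mem_commutant β (by linarith), h.summable⟩, h.tsum_eq⟩

theorem partition_eq (β : ℝ) (hβ : 2 < β) :
    (partition β : ℂ) = riemannZeta (β : ℂ) * riemannZeta ((β : ℂ) - 1) := by
  have h := zeta_eq_ofReal (β - 1) (by linarith)
  rw [Complex.ofReal_sub, Complex.ofReal_one] at h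
  rw [zeta_eq_ofReal β (by linarith), h, partition, Complex.ofReal_mul, mul_comm]

theorem detProj_trace (N : ℕ) (hN : 1 ≤ N) : IsGammaTraceable (detProj N) ∧
    gammaTrace (detProj N) = ((ArithmeticFunction.sigma 1 N : ℕ) : ℂ) := by
  classical
  have hb : ∀ m : M2Z, ‖(if m.mat.det = N then 1 else 0 : ℂ)‖ ≤ 1 := fun m => by
    split_ifs <;> simp
  have h : HasSum (orbitCoef (detProj N)) ((ArithmeticFunction.sigma 1 N : ℕ) : ℂ) := by
    have h1 := Complex.hasSum_ofReal.2 (sum_orbits_indicator N hN)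
    rw [Complex.ofReal_natCast] at h1
    refine orbitEquiv.hasSum_iff.1 (h1.congr_fun fun x => ?_)
    have h2 : orbitCoef (detProj N) (orbitEquiv x) = _ := orbitCoef_diagOp _ 1 zero_le_one hb _
    rw [Function.comp_apply, h2, det_out]
    simp only [Nat.cast_inj]
    split_ifs <;> simp
  refine ⟨⟨diagOp_mem_commutant _ 1 zero_le_one hb fun γ m => ?_, h.summable⟩, h.tsum_eq⟩
  rw [det_mat_smul]

/-! ### The representation `π` commutes with `ρ(Γ)` -/

/-- The factor `k`, the image of `γ⁻¹`, does not depend on `m`, so it cancels in the quotients `n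
m⁻¹` that index matrix coefficients. -/
theorem toGQ_smul (γ : SL(2, ℤ)) : ∃ k : GQ, ∀ m : M2Z, (γ • m).toGQ = m.toGQ * k := by
  refine ⟨M2Z.toGQ ⟨(γ⁻¹ : SL(2, ℤ)).1, by rw [(γ⁻¹ : SL(2, ℤ)).2]; exact one_pos⟩, fun m => ?_⟩
  apply Subtype.ext
  apply Units.ext
  exact Matrix.map_mul (f := Int.castRingHom ℚ)

theorem columns_smul_mem (γ : SL(2, ℤ)) (m : M2Z) (L : AddSubgroup (Fin 2 → ℤ))
    (h : ∀ j, (fun i => m.mat i j) ∈ L) : ∀ j, (fun i => (γ • m).mat i j) ∈ L := by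
  intro j
  have : (fun i => (γ • m).mat i j) = ∑ k, (γ⁻¹ : SL(2, ℤ)).1 k j • fun i => m.mat i k := by
    ext i
    simp only [smul_mat, Matrix.mul_apply, Finset.sum_apply, Pi.smul_apply, smul_eq_mul, mul_comm]
  rw [this]
  exact sum_mem fun k _ => L.zsmul_mem (h k) _

/-- The coefficient at `(m, n)` depends only on `n m⁻¹` and on whether the columns of `m` lie in
`L`. Right multiplication by `γ⁻¹` fixes the quotient and replaces the columns by integral
combinations of themselves, reversibly. -/
theorem piRep_muElem_mem_commutant (g : GQ) (L : AddSubgroup (Fin 2 → ℤ)) (h : IsAdmissible g L) :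
    piRep (muElem g L h) ∈ commutant := by
  classical
  rw [mem_commutant_iff]
  intro γ m n
  obtain ⟨k, hk⟩ := toGQ_smul γ
  have h1 : act (γ • m).toGQ 1 ∈ latticeSet L ↔ act m.toGQ 1 ∈ latticeSet L := by
    rw [act_one_mem_latticeSet _ L h.1, act_one_mem_latticeSet _ L h.1]
    refine ⟨fun hm => ?_, columns_smul_mem γ m L⟩
    simpa only [inv_smul_smul] using columns_smul_mem γ⁻¹ (γ • m) L hm
  have h2 : (γ • n).toGQ * (γ • m).toGQ⁻¹ = n.toGQ * m.toGQ⁻¹ := by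
    rw [hk, hk]; group
  have h3 : latticeProj L (act (γ • m).toGQ 1) = latticeProj L (act m.toGQ 1) := by
    rw [latticeProj, Set.indicator_apply, Set.indicator_apply]
    simp only [h1]
  rw [piRep_muElem_apply, piRep_muElem_apply, h2, h3]

theorem continuous_regUniv : Continuous regUniv := by
  refine (LipschitzWith.of_dist_le_mul (K := 1) fun a b => ?_).continuous
  rw [dist_eq_norm, dist_eq_norm, ← map_sub, NNReal.coe_one, one_mul]
  exact lp.norm_apply_le_norm (by simp) (a - b) regRep

/-- The centralizer of the self-adjoint family `ρ(Γ)` is a norm-closed star subalgebra, and `π` is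
continuous, so the generators suffice. -/
theorem piRep_mem_commutant (x : semigroupCStar) : piRep x ∈ commutant := by
  have h1 : semigroupCStar ≤
      (StarSubalgebra.centralizer ℂ (Set.range rightOp)).comap regUniv := by
    refine StarSubalgebra.topologicalClosure_minimal (StarAlgebra.adjoin_le ?_) ?_
    · rintro _ ⟨g, L, h, rfl⟩
      have h2 := Set.mem_centralizer_iff.1 (piRep_muElem_mem_commutant g L h)
      refine StarSubalgebra.mem_centralizer_iff ℂ |>.2 ?_
      rintro _ ⟨γ, rfl⟩
      refine ⟨h2 _ ⟨γ, rfl⟩, ?_⟩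
      -- The star centralizer also requires commutation with the adjoints, which are again of the
      -- form `ρ(γ⁻¹)`.
      rw [star_rightOp]
      exact h2 _ ⟨γ⁻¹, rfl⟩
    · have h2 : IsClosed (StarSubalgebra.centralizer ℂ (Set.range rightOp) : Set (HS →L[ℂ] HS)) := by
        rw [StarSubalgebra.coe_centralizer]
        exact Set.isClosed_centralizer _
      exact h2.preimage continuous_regUniv
  have h3 := (StarSubalgebra.mem_centralizer_iff ℂ).1 (h1 x.2)
  exact Set.mem_centralizer_iff.2 fun S hS => (h3 S hS).1

/-- Diagonal coefficients are at most `‖T‖`, so the series for `Z(β)`, scaled by `‖T‖`, dominates.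
-/
theorem summable_mul_exp (β : ℝ) (hβ : 2 < β) (T : HS →L[ℂ] HS) :
    Summable (orbitCoef (T * expNegH β)) := by
  refine Summable.of_norm_bounded ((hasSum_exp_energy β hβ).summable.mul_right ‖T‖) fun q => ?_
  rw [orbitCoef_mul_expNegH β (by linarith), norm_mul, Complex.norm_real, Real.norm_eq_abs,
    abs_of_pos (Real.exp_pos _)]
  gcongr
  exact norm_coef_le T _ _

theorem isGammaTraceable_mul_expNegH (β : ℝ) (hβ : 2 < β) (x : semigroupCStar) :
    IsGammaTraceable (piRep x * expNegH β) :=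
  ⟨Set.mul_mem_centralizer (piRep_mem_commutant x) (expNegH_mem_commutant β (by linarith)),
    summable_mul_exp β hβ _⟩

/-! ### The time evolution in the representation `π` -/

theorem detR_toGQ (m : M2Z) : detR m.toGQ = m.det := by
  have h : (m.mat.map (Int.cast : ℤ → ℚ)).det = (m.mat.det : ℚ) :=
    ((Int.castRingHom ℚ).map_det m.mat).symm
  rw [detR, M2Z.mat_toGQ, h, M2Z.det, Rat.cast_intCast]

theorem detPow_toGQ (t : ℝ) (n m : M2Z) : detPow t (n.toGQ * m.toGQ⁻¹) =
    Complex.exp (Complex.I * t * (energy n - energy m)) := by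
  have h : detR (n.toGQ * m.toGQ⁻¹) = n.det / m.det := by
    rw [eq_div_iff (zero_lt_one.trans_le m.one_le_det).ne', ← detR_toGQ m, ← detR_mul,
      inv_mul_cancel_right, detR_toGQ]
  rw [detPow_eq, h, Real.log_div (zero_lt_one.trans_le n.one_le_det).ne'
    (zero_lt_one.trans_le m.one_le_det).ne', energy, energy]
  congr 1
  push_cast
  ring

/-- `π(σ_t(b)) = e^{itH} π(b) e^{-itH}`, in terms of matrix coefficients. -/
theorem piRep_sigma (t : ℝ) (b : semigroupCStar) (m n : M2Z) :
    piRep (sigma t b) (basisVec m) n =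
      Complex.exp (Complex.I * t * (energy n - energy m)) * piRep b (basisVec m) n := by
  have hcont : ∀ m n : M2Z, Continuous fun a : Univ => regUniv a (basisVec m) n := fun m n =>
    (lp.evalCLM ℂ (fun _ : M2Z => ℂ) 2 n).continuous.comp
      ((ContinuousLinearMap.apply ℂ HS (basisVec m)).continuous.comp continuous_regUniv)
  have hcl : IsClosed {a : Univ | regUniv (evolveUniv t a) (basisVec m) n =
      Complex.exp (Complex.I * t * (energy n - energy m)) * regUniv a (basisVec m) n} :=
    isClosed_eq ((hcont m n).comp (continuous_evolveUniv t)) (continuous_const.mul (hcont m n))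
  -- The identity is closed in `a`, so it is checked on the dense image of `C_c(G₂)` in the larger
  -- algebra `A`. There the coefficient is the value of `f` on the slice over `n m⁻¹`, on which
  -- `σ_t` multiplies by `det(n m⁻¹)^{it}`.
  refine closure_minimal ?_ hcl (semigroupCStar_le b.2)
  rintro _ ⟨f, rfl⟩
  change regOp (evolveFun t f) (basisVec m) n = _ * regOp f (basisVec m) n
  rw [regOp_basisVec, regOp_basisVec, coef, ev_evolveFun, detPow_toGQ, coef]

/-! ### Sums over the orbits of pairs -/

/-- `Γ` acts freely, so `M₂(ℤ)⁺` is the product of `Γ` and the set of orbits. -/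
def orbitProd : Orbits × SL(2, ℤ) ≃ M2Z :=
  Equiv.ofBijective (fun x => x.2 • x.1.out) <| by
    constructor
    · rintro ⟨q, γ⟩ ⟨p, δ⟩ h
      have hq : q = p := by
        have h1 : (Quotient.mk'' q.out : Orbits) = Quotient.mk'' p.out :=
          (orbit_eq_iff _ _).2 ⟨γ⁻¹ * δ, by rw [mul_smul, eq_inv_smul_iff]; exact h⟩
        rwa [Quotient.out_eq', Quotient.out_eq'] at h1
      subst hq
      exact Prod.ext rfl (smul_left_injective _ h)
    · intro m
      obtain ⟨γ, h⟩ := exists_smul_out m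
      exact ⟨(_, γ), h⟩

/-- The two parametrizations of the orbits of pairs `(x, y)` by pairs with `x`, resp. `y`, in the
chosen set of representatives. -/
def pairSwap : Orbits × M2Z ≃ Orbits × M2Z :=
  ((Equiv.refl Orbits).prodCongr orbitProd.symm).trans <|
    Equiv.trans
      -- With chosen representatives `q` and `p`, the pair `(q, γp)` is translated by `γ⁻¹` to
      -- `(γ⁻¹q, p)`; the coordinates are then exchanged so that the normalized one comes first.
      { toFun := fun x : Orbits × Orbits × SL(2, ℤ) => (x.2.1, x.1, x.2.2⁻¹)
        invFun := fun x => (x.2.1, x.1, x.2.2⁻¹)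
        left_inv := fun x => by simp
        right_inv := fun x => by simp }
      ((Equiv.refl Orbits).prodCongr orbitProd)

/-- The pairs `(q, γp)` and `(γ⁻¹q, p)` lie in one diagonal orbit, so an invariant function agrees
on them. This replaces the cyclicity of the trace. -/
theorem pairSwap_apply {β : Type*} (f : M2Z → M2Z → β)
    (hf : ∀ (γ : SL(2, ℤ)) (x y : M2Z), f (γ • x) (γ • y) = f x y) (x : Orbits × M2Z) :
    f (pairSwap x).2 (pairSwap x).1.out = f x.1.out x.2 := by
  obtain ⟨q, n⟩ := x
  obtain ⟨⟨p, γ⟩, rfl⟩ := orbitProd.surjective n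
  have h : pairSwap (q, orbitProd (p, γ)) = (p, γ⁻¹ • q.out) := by
    simp only [pairSwap, Equiv.trans_apply, Equiv.prodCongr_apply, Prod.map_apply,
      Equiv.symm_apply_apply]
    rfl
  rw [h]
  change f (γ⁻¹ • q.out) p.out = f q.out (γ • p.out)
  rw [← hf γ, smul_inv_smul]

/-- Summing over the second variable first gives `‖T ε_m‖² ≤ ‖T‖²`, which leaves the convergent
series for `Z(β)`. -/
theorem summable_coef_sq (β : ℝ) (hβ : 2 < β) (T : HS →L[ℂ] HS) : Summable fun x : Orbits × M2Z =>
    ‖T (basisVec x.1.out) x.2‖ ^ 2 * Real.exp (-β * energy x.1.out) := by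
  have h := fun q : Orbits =>
    (hasSum_norm_sq (T (basisVec q.out))).mul_right (Real.exp (-β * energy q.out))
  refine (summable_prod_of_nonneg fun x => by positivity).2 ⟨fun q => (h q).summable, ?_⟩
  refine Summable.of_nonneg_of_le (fun q => tsum_nonneg fun n => by positivity) (fun q => ?_)
    ((hasSum_exp_energy β hβ).summable.mul_left (‖T‖ ^ 2))
  rw [(h q).tsum_eq]
  gcongr
  refine (T.le_opNorm _).trans ?_
  rw [norm_basisVec, mul_one]

/-- Up to conjugation the rows of `T` are the columns of its adjoint. -/
theorem summable_coef_sq_transpose (β : ℝ) (hβ : 2 < β) (T : HS →L[ℂ] HS) :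
    Summable fun x : Orbits × M2Z =>
      ‖T (basisVec x.2) x.1.out‖ ^ 2 * Real.exp (-β * energy x.1.out) := by
  refine (summable_coef_sq β hβ (star T)).congr fun x => ?_
  rw [star_op_apply, RCLike.norm_conj]

theorem coef_sq_invariant {T : HS →L[ℂ] HS} (hT : T ∈ commutant) (γ : SL(2, ℤ)) (x y : M2Z) :
    ‖T (basisVec (γ • x)) (γ • y)‖ ^ 2 = ‖T (basisVec x) y‖ ^ 2 := by
  rw [(mem_commutant_iff T).1 hT]

/-! ### Convergence and holomorphy of the KMS function -/

/-- A bound for the terms of the sum that defines the KMS function. -/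
def kmsBound (β : ℝ) (A B : HS →L[ℂ] HS) (x y : M2Z) : ℝ :=
  (‖A (basisVec y) x‖ ^ 2 + ‖B (basisVec x) y‖ ^ 2) *
    (Real.exp (-β * energy x) + Real.exp (-β * energy y))

/-- Expanding the product gives four series. The two weighted at the representative `x` are square
sums along rows of `A` and columns of `B`. The two weighted at `y` reduce to such sums by
`pairSwap`, and it is here that invariance under `Γ` is needed. -/
theorem summable_kmsBound (β : ℝ) (hβ : 2 < β) {A B : HS →L[ℂ] HS} (hA : A ∈ commutant)
    (hB : B ∈ commutant) : Summable fun x : Orbits × M2Z => kmsBound β A B x.1.out x.2 := by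
  have hA1 := summable_coef_sq_transpose β hβ A
  have hB1 := summable_coef_sq β hβ B
  have hA2 := (pairSwap.summable_iff).2 (summable_coef_sq β hβ A)
  have hB2 := (pairSwap.summable_iff).2 (summable_coef_sq_transpose β hβ B)
  refine (((hA1.add hB1).add (hA2.add hB2))).congr fun x => ?_
  have h1 := pairSwap_apply (fun x y => ‖A (basisVec y) x‖ ^ 2 * Real.exp (-β * energy y))
    (fun γ x y => by rw [coef_sq_invariant hA, energy_smul]) x
  have h2 := pairSwap_apply (fun x y => ‖B (basisVec x) y‖ ^ 2 * Real.exp (-β * energy y))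
    (fun γ x y => by rw [coef_sq_invariant hB, energy_smul]) x
  simp only [Function.comp_apply]
  rw [h1, h2, kmsBound]
  ring

/-- The terms of the sum that defines the KMS function. -/
def kmsTerm (β : ℝ) (A B : HS →L[ℂ] HS) (z : ℂ) (x y : M2Z) : ℂ :=
  A (basisVec y) x * B (basisVec x) y *
    Complex.exp (Complex.I * z * energy y - (Complex.I * z + β) * energy x)

theorem differentiable_kmsTerm (β : ℝ) (A B : HS →L[ℂ] HS) (x y : M2Z) :
    Differentiable ℂ fun z => kmsTerm β A B z x y := by
  unfold kmsTerm
  fun_prop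

theorem kmsTerm_smul (β : ℝ) {A B : HS →L[ℂ] HS} (hA : A ∈ commutant) (hB : B ∈ commutant) (z : ℂ)
    (γ : SL(2, ℤ)) (x y : M2Z) : kmsTerm β A B z (γ • x) (γ • y) = kmsTerm β A B z x y := by
  rw [kmsTerm, kmsTerm, (mem_commutant_iff A).1 hA, (mem_commutant_iff B).1 hB, energy_smul,
    energy_smul]

/-- With `s = Im z`, the exponential has modulus `exp(-s E(y) - (β - s) E(x))`, where `E` is
`energy`. The exponent is a convex combination of `-β E(x)` and `-β E(y)`, so the modulus is at most
the larger endpoint value, hence at most their sum. The two coefficients are separated by `|u v| ≤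
|u|² + |v|²`. -/
theorem kmsTerm_norm_le (β : ℝ) (A B : HS →L[ℂ] HS) (z : ℂ) (h0 : 0 ≤ z.im) (h1 : z.im ≤ β)
    (x y : M2Z) : ‖kmsTerm β A B z x y‖ ≤ kmsBound β A B x y := by
  rw [kmsTerm, kmsBound, norm_mul, norm_mul, Complex.norm_exp]
  have hx := energy_nonneg x
  have hy := energy_nonneg y
  have hre : (Complex.I * z * energy y - (Complex.I * z + β) * energy x).re =
      -z.im * energy y - (β - z.im) * energy x := by
    simp only [Complex.sub_re, Complex.mul_re, Complex.mul_im, Complex.add_re, Complex.add_im,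
      Complex.I_re, Complex.I_im, Complex.ofReal_re, Complex.ofReal_im]
    ring
  rw [hre]
  have hexp : Real.exp (-z.im * energy y - (β - z.im) * energy x) ≤
      Real.exp (-β * energy x) + Real.exp (-β * energy y) := by
    rcases le_total (energy x) (energy y) with h | h
    · refine le_trans (Real.exp_le_exp.2 ?_) (le_add_of_nonneg_right (Real.exp_pos _).le)
      nlinarith [mul_nonneg h0 (sub_nonneg.2 h)]
    · refine le_trans (Real.exp_le_exp.2 ?_) (le_add_of_nonneg_left (Real.exp_pos _).le)
      nlinarith [mul_nonneg (sub_nonneg.2 h1) (sub_nonneg.2 h)]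
  refine mul_le_mul ?_ hexp (Real.exp_pos _).le (by positivity)
  nlinarith [sq_nonneg (‖A (basisVec y) x‖ - ‖B (basisVec x) y‖),
    sq_nonneg ‖A (basisVec y) x‖, sq_nonneg ‖B (basisVec x) y‖]

/-- The KMS function `Trace_Γ(A e^{izH} B e^{-izH} e^{-βH})`. -/
def kmsFun (β : ℝ) (A B : HS →L[ℂ] HS) (z : ℂ) : ℂ :=
  ∑' x : Orbits × M2Z, kmsTerm β A B z x.1.out x.2

theorem summable_kmsTerm (β : ℝ) (hβ : 2 < β) {A B : HS →L[ℂ] HS} (hA : A ∈ commutant)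
    (hB : B ∈ commutant) (z : ℂ) (h0 : 0 ≤ z.im) (h1 : z.im ≤ β) :
    Summable fun x : Orbits × M2Z => kmsTerm β A B z x.1.out x.2 :=
  Summable.of_norm_bounded (summable_kmsBound β hβ hA hB) fun _ => kmsTerm_norm_le β A B z h0 h1 _ _

/-- The dominating series does not depend on `z`, so convergence is uniform on the closed strip. The
same bound yields holomorphy in the interior and boundedness below. -/
theorem continuousOn_kmsFun (β : ℝ) (hβ : 2 < β) {A B : HS →L[ℂ] HS} (hA : A ∈ commutant)
    (hB : B ∈ commutant) : ContinuousOn (kmsFun β A B) {z | 0 ≤ z.im ∧ z.im ≤ β} :=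
  continuousOn_tsum (fun x => (differentiable_kmsTerm β A B x.1.out x.2).continuous.continuousOn)
    (summable_kmsBound β hβ hA hB) fun _ z hz => kmsTerm_norm_le β A B z hz.1 hz.2 _ _

theorem differentiableOn_kmsFun (β : ℝ) (hβ : 2 < β) {A B : HS →L[ℂ] HS} (hA : A ∈ commutant)
    (hB : B ∈ commutant) : DifferentiableOn ℂ (kmsFun β A B) {z | 0 < z.im ∧ z.im < β} :=
  Complex.differentiableOn_tsum_of_summable_norm (summable_kmsBound β hβ hA hB)
    (fun x => (differentiable_kmsTerm β A B x.1.out x.2).differentiableOn)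
    ((isOpen_lt continuous_const Complex.continuous_im).inter
      (isOpen_lt Complex.continuous_im continuous_const))
    fun _ z hz => kmsTerm_norm_le β A B z hz.1.le hz.2.le _ _

theorem norm_kmsFun_le (β : ℝ) (hβ : 2 < β) {A B : HS →L[ℂ] HS} (hA : A ∈ commutant)
    (hB : B ∈ commutant) (z : ℂ) (h0 : 0 ≤ z.im) (h1 : z.im ≤ β) :
    ‖kmsFun β A B z‖ ≤ ∑' x : Orbits × M2Z, kmsBound β A B x.1.out x.2 :=
  tsum_of_norm_bounded (summable_kmsBound β hβ hA hB).hasSum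
    fun _ => kmsTerm_norm_le β A B z h0 h1 _ _

/-! ### Boundary values of the KMS function -/

theorem piRep_add (x y : semigroupCStar) : piRep (x + y) = piRep x + piRep y := rfl

theorem piRep_smul (c : ℂ) (x : semigroupCStar) : piRep (c • x) = c • piRep x := rfl

theorem piRep_mul (x y : semigroupCStar) : piRep (x * y) = piRep x * piRep y := rfl

theorem piRep_one : piRep 1 = 1 := rfl

theorem piRep_star (x : semigroupCStar) : piRep (star x) = star (piRep x) := rfl

/-- For real `z` the exponential splits into the weight `e^{-βE(x)}` and the phase by which `σ_t`
multiplies the coefficient of `π(b)`. The inner sum over `y` is then the matrix product at the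
diagonal entry `x`. -/
theorem kmsFun_real (β : ℝ) (hβ : 2 < β) (a b : semigroupCStar) (t : ℝ) :
    kmsFun β (piRep a) (piRep b) t = phi β (a * sigma t b) := by
  rw [kmsFun, (summable_kmsTerm β hβ (piRep_mem_commutant a) (piRep_mem_commutant b) t (by simp)
    (by simp; linarith)).tsum_prod, phi, gammaTrace]
  refine tsum_congr fun q => ?_
  rw [orbitCoef_mul_expNegH β (by linarith), piRep_mul, mul_coef, ← tsum_mul_left]
  refine tsum_congr fun n => ?_
  rw [piRep_sigma, kmsTerm, Complex.ofReal_exp,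
    show Complex.I * t * energy n - (Complex.I * t + β) * energy q.out =
      ((-β * energy q.out : ℝ) : ℂ) + Complex.I * t * (energy n - energy q.out) by push_cast; ring,
    Complex.exp_add]
  ring

/-- At `z = t + iβ` the whole weight has moved to `y`. Reindexing by `pairSwap` makes `y` the
representative and `x` the free variable, so the inner sum becomes the diagonal coefficient of the
product in the opposite order. -/
theorem kmsFun_top (β : ℝ) (hβ : 2 < β) (a b : semigroupCStar) (t : ℝ) :
    kmsFun β (piRep a) (piRep b) (t + Complex.I * β) = phi β (sigma t b * a) := by
  have hA := piRep_mem_commutant a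
  have hB := piRep_mem_commutant b
  have hs := summable_kmsTerm β hβ hA hB (t + Complex.I * β) (by simp; linarith) (by simp)
  have h1 : (fun x : Orbits × M2Z =>
      kmsTerm β (piRep a) (piRep b) (t + Complex.I * β) x.1.out x.2) =
      (fun x : Orbits × M2Z =>
        kmsTerm β (piRep a) (piRep b) (t + Complex.I * β) x.2 x.1.out) ∘ pairSwap :=
    funext fun x => (pairSwap_apply _ (kmsTerm_smul β hA hB _) x).symm
  rw [h1] at hs
  rw [kmsFun, h1]
  refine (pairSwap.tsum_eq fun x : Orbits × M2Z =>
    kmsTerm β (piRep a) (piRep b) (t + Complex.I * β) x.2 x.1.out).trans ?_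
  rw [(pairSwap.summable_iff.1 hs).tsum_prod, phi, gammaTrace]
  refine tsum_congr fun p => ?_
  rw [orbitCoef_mul_expNegH β (by linarith), piRep_mul, mul_coef, ← tsum_mul_left]
  refine tsum_congr fun m => ?_
  -- Here `iz = it - β`: the coefficient `iz + β` of `-energy m` loses its real part, while `energy
  -- p.out` acquires the factor `-β`.
  have hI : Complex.I * (t + Complex.I * β) * energy p.out -
      (Complex.I * (t + Complex.I * β) + β) * energy m =
      ((-β * energy p.out : ℝ) : ℂ) + Complex.I * t * (energy p.out - energy m) := by
    push_cast
    linear_combination (β * energy p.out - β * energy m : ℂ) * Complex.I_mul_I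
  rw [piRep_sigma, kmsTerm, Complex.ofReal_exp, hI, Complex.exp_add]
  ring

/-! ### The state -/

theorem phi_add (β : ℝ) (hβ : 2 < β) (x y : semigroupCStar) :
    phi β (x + y) = phi β x + phi β y := by
  rw [phi, phi, phi, gammaTrace, gammaTrace, gammaTrace,
    ← (summable_mul_exp β hβ _).tsum_add (summable_mul_exp β hβ _)]
  refine tsum_congr fun q => ?_
  rw [piRep_add, add_mul, orbitCoef, orbitCoef, orbitCoef, add_apply, inner_add_right]

theorem phi_smul (β : ℝ) (c : ℂ) (x : semigroupCStar) : phi β (c • x) = c * phi β x := by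
  rw [phi, phi, gammaTrace, gammaTrace, ← tsum_mul_left]
  refine tsum_congr fun q => ?_
  rw [piRep_smul, smul_mul_assoc, orbitCoef, orbitCoef, smul_apply, inner_smul_right]

theorem phi_one (β : ℝ) : phi β 1 = Z β := by
  rw [phi, piRep_one, one_mul, Z]

/-- On basis vectors `e^{-βH}` is a positive scalar, and the diagonal coefficient of `π(a)* π(a)` at
`m` is `‖π(a) ε_m‖²`, so every term of the trace is nonnegative. -/
theorem phi_star_mul_self_nonneg (β : ℝ) (hβ : 2 < β) (a : semigroupCStar) :
    0 ≤ phi β (star a * a) := by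
  have h : phi β (star a * a) = ((∑' q : Orbits, Real.exp (-β * energy q.out) *
      ‖piRep a (basisVec q.out)‖ ^ 2 : ℝ) : ℂ) := by
    rw [phi, gammaTrace, Complex.ofReal_tsum]
    refine tsum_congr fun q => ?_
    rw [orbitCoef_mul_expNegH β (by linarith), piRep_mul, piRep_star, star_mul_self_coef,
      Complex.ofReal_mul]
  rw [h]
  exact Complex.zero_le_real.2 (tsum_nonneg fun q => by positivity)

set_option synthInstance.maxHeartbeats 200000 in
theorem isKMSState_phi (β : ℝ) (hβ : 2 < β) :
    IsKMSState (fun t x => sigma t x) β (fun x : semigroupCStar => (Z β)⁻¹ * phi β x) where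
  linear := IsLinearMap.mk
    (fun x y => (congrArg ((Z β)⁻¹ * ·) (phi_add β hβ x y)).trans (mul_add _ _ _))
    (fun c x => (congrArg ((Z β)⁻¹ * ·) (phi_smul β c x)).trans (mul_left_comm _ _ _))
  map_one := by
    rw [phi_one, (isGammaTraceable_expNegH β hβ).2]
    exact inv_mul_cancel₀ (Complex.ofReal_ne_zero.2 (partition_pos β hβ).ne')
  nonneg a := by
    rw [(isGammaTraceable_expNegH β hβ).2, ← Complex.ofReal_inv]
    exact mul_nonneg (Complex.zero_le_real.2 (inv_pos.2 (partition_pos β hβ)).le)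
      (phi_star_mul_self_nonneg β hβ a)
  kms a b := by
    have hA := piRep_mem_commutant a
    have hB := piRep_mem_commutant b
    refine ⟨fun z => (Z β)⁻¹ * kmsFun β (piRep a) (piRep b) z,
      continuousOn_const.mul (continuousOn_kmsFun β hβ hA hB),
      (differentiableOn_kmsFun β hβ hA hB).const_mul _,
      ⟨‖(Z β)⁻¹‖ * ∑' x : Orbits × M2Z, kmsBound β (piRep a) (piRep b) x.1.out x.2,
        fun z h0 h1 => ?_⟩, fun t => ⟨?_, ?_⟩⟩
    · rw [norm_mul]
      exact mul_le_mul_of_nonneg_left (norm_kmsFun_le β hβ hA hB z h0 h1) (norm_nonneg _)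
    · exact congrArg ((Z β)⁻¹ * ·) (kmsFun_real β hβ a b t)
    · exact congrArg ((Z β)⁻¹ * ·) (kmsFun_top β hβ a b t)

end DetSystem

end

theorem mainTheorem10 :
    (∀ N : ℕ, 1 ≤ N →
      DetSystem.IsGammaTraceable (DetSystem.detProj N) ∧
      DetSystem.gammaTrace (DetSystem.detProj N) = ((ArithmeticFunction.sigma 1 N : ℕ) : ℂ)) ∧
    (∀ β : ℝ, 2 < β →
      DetSystem.IsGammaTraceable (DetSystem.expNegH β) ∧
      DetSystem.Z β = riemannZeta (β : ℂ) * riemannZeta ((β : ℂ) - 1)) ∧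
    (∀ β : ℝ, 2 < β →
      (∀ x : DetSystem.semigroupCStar,
        DetSystem.IsGammaTraceable (DetSystem.piRep x * DetSystem.expNegH β)) ∧
      DetSystem.IsKMSState (fun t x => DetSystem.sigma t x) β
        (fun x : DetSystem.semigroupCStar => (DetSystem.Z β)⁻¹ * DetSystem.phi β x)) :=
  ⟨DetSystem.detProj_trace,
    fun β hβ => ⟨(DetSystem.isGammaTraceable_expNegH β hβ).1,
      (DetSystem.isGammaTraceable_expNegH β hβ).2.trans (DetSystem.partition_eq β hβ)⟩,
    fun β hβ => ⟨DetSystem.isGammaTraceable_mul_expNegH β hβ, DetSystem.isKMSState_phi β hβ⟩⟩
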